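/- **Theorem.** Two items are sold one after the other, each in a sealed-bid first-price auction; ties are broken by a fair coin. There are three bidders $a,b,c$ with values $v_a,v_b,v_c$ that are independent, privately known and uniformly distributed on $[0,1]$. Bidders $a$ and $b$ want one item and value either of them at $v_a$, respectively $v_b$; bidder $c$ only wants the second item and values it at $v_c$. Bids are numbers in $[0,1]$. In the first auction $a$ and $b$ bid; its winner and the winning price $p$ are then announced, the winner leaves, and the loser and $c$ bid in the second auction. Utilities are quasi-linear and bidders are risk neutral. An *assessment* consists of a (pure, measurable) strategy for each bidder and of beliefs: after each history (winner, price $p$), a common probability distribution for the value of each bidder, with the values of different bidders independent. It is a *sequential equilibrium* if (i) (sequential rationality) at each information set, the continuation strategy of the bidder who moves there maximizes this bidder's expected utility under the beliefs among all continuation strategies, and (ii) (consistency) the beliefs after each history are the weak limit, as $\epsilon\to0^+$, of the Bayesian updates of the prior in the case that $a$ and $b$, independently, follow their first-auction strategies with probability $1-\epsilon$ and bid uniformly at random in $[0,1]$ with probability $\epsilon$; here the Bayesian update given (winner $w$, price $p$) is the weak limit, as $\delta\to0^+$, of the conditional law of the values given that $w$ won at a price in $(p-\delta,p+\delta)$.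 In (i) and (ii) only histories with $p\in(0,1]$ are considered (the price $0$ arises only if both bids in the first auction are $0$, which has probability $0$ both with and without the perturbation when the bids are as below). The game has a sequential equilibrium such that: 1. In the first auction, $a$ and $b$ bid $b(v)=1-\frac{\ln(1+v)}{v}$ for $v\in(0,1]$, and $b(0)=0$. 2. If the first auction was won at the price $b(x)$ with $x\in(0,1]$, then the loser's value is believed to be uniformly distributed on $[0,x]$. If it was won at a price $p\in(b(1),1]=(1-\ln 2,1]$, then the loser's value is believed to be uniformly distributed on $[0,1]$. After every price $p\in(0,1]$, the value of $c$ is believed to be uniformly distributed on $[0,1]$. 3. If the first auction was won at the price $b(x)$ with $x\in(0,1]$, then with $k=\frac1{x^2}-1$ the loser with value $v\in[0,x]$ bids $\frac{v}{1+\sqrt{1-kv^2}}$ in the second auction, and $c$ with value $v\in[0,1]$ bids $\frac{v}{1+\sqrt{1+kv^2}}$. After a price $p\in(1-\ln 2,1]$, both bid $v/2$. -/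

import Mathlib

open MeasureTheory ProbabilityTheory Filter Topology Set
open scoped BoundedContinuousFunction

namespace SequentialAuction

noncomputable section

/-- The uniform distribution on `[0, x]` (for `x > 0`). The common prior of every value is
`uniform 1`. -/
def uniform (x : ℝ) : Measure ℝ := ProbabilityTheory.cond volume (Icc 0 x)

/-- The two bidders who take part in the first auction. The third bidder `c` takes part only in the
second auction, against the loser of the first one. -/
inductive Early
  | a
  | b

/-- The opponent in the first auction. -/
def Early.other : Early → Early
  | Early.a => Early.b
  | Early.b => Early.a

/-- A (pure, measurable) strategy profile. Values and bids are numbers in `[0, 1]`. The public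
history before the second auction consists of the winner `w` of the first auction and the winning
price `p`; a bid in the second auction is a function of that history and of the bidder's value. -/
structure StrategyProfile where
  /-- `first i v`: the bid of `i` with value `v` in the first auction -/
  first : Early → ℝ → ℝ
  /-- `loser w p v`: the bid in the second auction of the bidder (with value `v`) who lost the first
  auction to `w` at price `p` -/
  loser : Early → ℝ → ℝ → ℝ
  /-- `late w p v`: the bid of `c` with value `v` in the second auction, after `w` won the first
  auction at price `p` -/
  late : Early → ℝ → ℝ → ℝ
  measurable_first : ∀ i, Measurable (first i)
  measurable_loser : ∀ w, Measurable (Function.uncurry (loser w))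
  measurable_late : ∀ w, Measurable (Function.uncurry (late w))
  first_mem : ∀ i, ∀ v ∈ Icc (0 : ℝ) 1, first i v ∈ Icc (0 : ℝ) 1
  loser_mem : ∀ w, ∀ p ∈ Icc (0 : ℝ) 1, ∀ v ∈ Icc (0 : ℝ) 1, loser w p v ∈ Icc (0 : ℝ) 1
  late_mem : ∀ w, ∀ p ∈ Icc (0 : ℝ) 1, ∀ v ∈ Icc (0 : ℝ) 1, late w p v ∈ Icc (0 : ℝ) 1

/-- A belief system: after the history `(w, p)`, the common belief about the value of each bidder.
Values of different bidders are independent under the beliefs. -/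
structure BeliefSystem where
  /-- `early w p j`: the belief about the value of `j` after `w` won the first auction at price `p` -/
  early : Early → ℝ → Early → ProbabilityMeasure ℝ
  /-- `late w p`: the belief about the value of `c` after `w` won the first auction at price `p` -/
  late : Early → ℝ → ProbabilityMeasure ℝ

/-- The joint belief about `(v_a, v_b, v_c)` after the history `(w, p)`. -/
def BeliefSystem.joint (μ : BeliefSystem) (w : Early) (p : ℝ) : ProbabilityMeasure (ℝ × ℝ × ℝ) :=
  (μ.early w p Early.a).prod ((μ.early w p Early.b).prod (μ.late w p))

/-- The probability that bid `x` wins against bid `y`: the higher bid wins, ties are broken by a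
fair coin. -/
def winProb (x y : ℝ) : ℝ := if y < x then 1 else if x = y then 1 / 2 else 0

/-! ### Payoffs -/

/-- Expected payoff in the second auction of the loser of the first one, with value `v` and bid `β`,
under the belief about `c` after the history `(w, p)`. -/
def loserPayoff (σ : StrategyProfile) (μ : BeliefSystem) (w : Early) (p v β : ℝ) : ℝ :=
  ∫ t, winProb β (σ.late w p t) * (v - β) ∂(μ.late w p : Measure ℝ)

/-- Expected payoff in the second auction of `c`, with value `v` and bid `β`, under the belief about
the loser of the first auction after the history `(w, p)`. -/
def latePayoff (σ : StrategyProfile) (μ : BeliefSystem) (w : Early) (p v β : ℝ) : ℝ :=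
  ∫ t, winProb β (σ.loser w p t) * (v - β) ∂(μ.early w p w.other : Measure ℝ)

/-- Expected payoff from the whole game of the early bidder `i` with value `v` who bids `β` in the
first auction and, when losing it at price `p`, bids `d p` in the second one, while the others follow
`σ`. Here `t` is the value of the opponent in the first auction and `u` that of `c`. A winner of the
first auction pays the own bid and leaves. -/
def earlyPayoff (σ : StrategyProfile) (i : Early) (v β : ℝ) (d : ℝ → ℝ) : ℝ :=
  ∫ t, (winProb β (σ.first i.other t) * (v - β)
      + winProb (σ.first i.other t) β *
        ∫ u, winProb (d (σ.first i.other t)) (σ.late i.other (σ.first i.other t) u)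
          * (v - d (σ.first i.other t)) ∂(uniform 1)) ∂(uniform 1)

/-- Sequential rationality: at each information set, the continuation strategy of the player who
moves there is optimal, given the beliefs, among all continuation strategies. Histories with price
`0`, which arise only if both bids in the first auction are `0`, are left out. -/
structure IsSequentiallyRational (σ : StrategyProfile) (μ : BeliefSystem) : Prop where
  first : ∀ i, ∀ v ∈ Icc (0 : ℝ) 1, ∀ β ∈ Icc (0 : ℝ) 1, ∀ d : ℝ → ℝ, Measurable d →
    (∀ p ∈ Icc (0 : ℝ) 1, d p ∈ Icc (0 : ℝ) 1) →
    earlyPayoff σ i v β d ≤ earlyPayoff σ i v (σ.first i v) (fun p => σ.loser i.other p v)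
  loser : ∀ w, ∀ p ∈ Ioc (0 : ℝ) 1, ∀ v ∈ Icc (0 : ℝ) 1, ∀ β ∈ Icc (0 : ℝ) 1,
    loserPayoff σ μ w p v β ≤ loserPayoff σ μ w p v (σ.loser w p v)
  late : ∀ w, ∀ p ∈ Ioc (0 : ℝ) 1, ∀ v ∈ Icc (0 : ℝ) 1, ∀ β ∈ Icc (0 : ℝ) 1,
    latePayoff σ μ w p v β ≤ latePayoff σ μ w p v (σ.late w p v)

/-! ### Bayesian updates under perturbed strategies -/

/-- Joint law of the value and the bid of a player who bids `s v` with probability `1 - ε` and, with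
probability `ε`, a uniformly random number in `[0, 1]`. -/
def perturbedBidder (ε : ℝ) (s : ℝ → ℝ) : Measure (ℝ × ℝ) :=
  ENNReal.ofReal (1 - ε) • (uniform 1).map (fun v => (v, s v))
    + ENNReal.ofReal ε • (uniform 1).prod (uniform 1)

/-- A play of the first auction: `((v_a, x_a), (v_b, x_b), v_c, coin)` with values `v`, bids `x`, and
a number in `[0, 1]` that breaks ties. -/
abbrev Play := (ℝ × ℝ) × (ℝ × ℝ) × ℝ × ℝ

/-- The law of a play of the first auction under the `ε`-perturbed strategies. -/
def perturbedLaw (σ : StrategyProfile) (ε : ℝ) : Measure Play :=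
  (perturbedBidder ε (σ.first Early.a)).prod
    ((perturbedBidder ε (σ.first Early.b)).prod ((uniform 1).prod (uniform 1)))

/-- The values `(v_a, v_b, v_c)`. -/
def values (ω : Play) : ℝ × ℝ × ℝ := (ω.1.1, ω.2.1.1, ω.2.2.1)

/-- The winner of the first auction. -/
def winner (ω : Play) : Early :=
  if ω.2.1.2 < ω.1.2 then Early.a
  else if ω.1.2 < ω.2.1.2 then Early.b
  else if ω.2.2.2 < 1 / 2 then Early.a else Early.b

/-- The winning price of the first auction. -/
def price (ω : Play) : ℝ := max ω.1.2 ω.2.1.2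

/-- The event that `w` wins the first auction at a price within `δ` of `p`. -/
def nearHistory (w : Early) (p δ : ℝ) : Set Play := {ω | winner ω = w ∧ |price ω - p| < δ}

/-- `ν` is the Bayesian update of the values given the history `(w, p)` under the `ε`-perturbed
strategies: the weak limit of the conditional laws given that `w` won at a price within `δ` of `p`,
as `δ → 0`. -/
def IsPosterior (σ : StrategyProfile) (ε : ℝ) (w : Early) (p : ℝ)
    (ν : ProbabilityMeasure (ℝ × ℝ × ℝ)) : Prop :=
  ∀ f : (ℝ × ℝ × ℝ) →ᵇ ℝ,
    Tendsto
      (fun δ => ∫ ω, f (values ω) ∂(ProbabilityTheory.cond (perturbedLaw σ ε) (nearHistory w p δ)))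
      (𝓝[>] (0 : ℝ)) (𝓝 (∫ x, f x ∂(ν : Measure (ℝ × ℝ × ℝ))))

/-- Consistency: at each history with a price in `(0, 1]` the beliefs are the (weak) limits, as
`ε → 0`, of the Bayesian updates under the `ε`-perturbed strategies. -/
def IsConsistent (σ : StrategyProfile) (μ : BeliefSystem) : Prop :=
  ∀ w, ∀ p ∈ Ioc (0 : ℝ) 1, ∃ ν : ℝ → ProbabilityMeasure (ℝ × ℝ × ℝ),
    (∀ ε ∈ Ioo (0 : ℝ) 1, IsPosterior σ ε w p (ν ε)) ∧
    Tendsto ν (𝓝[>] (0 : ℝ)) (𝓝 (μ.joint w p))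

/-- A sequential equilibrium is a sequentially rational and consistent assessment. -/
structure IsSequentialEquilibrium (σ : StrategyProfile) (μ : BeliefSystem) : Prop where
  rational : IsSequentiallyRational σ μ
  consistent : IsConsistent σ μ

end

end SequentialAuction

namespace SequentialAuction

noncomputable section

/-! Put k = 1/x² - 1. After the price b(x) the second auction is a first-price auction between
values uniform on [0, x] (loser) and on [0, 1] (bidder c). The two bid functions have inverses β ↦
2β/(1 + kβ²) and β ↦ 2β/(1 - kβ²) and the common top bid x/(1 + x). The loser with value v = 2b/(1 +
kb²) thus gets 2β(v - β)/(1 - kβ²) from a bid β, and this falls short of vb by a positive multiple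
of (b - β)². For c the sign of k is reversed. This gives `loser_optimal` and `late_optimal`.

In the first auction, losing against the value t is worth `loserGain v t`, which is at least v -
t/(1 + t), the payoff from outbidding c for sure, with equality if t ≤ v. So winning at β instead of
losing gains at most t/(1 + t) - β. With y = `invBid β`, a bid β beats almost exactly the values t <
y, so the total gain is at most the integral of t/(1 + t) - β over [0, y]. Since y b(y) = y - ln(1 +
y) is the integral of t/(1 + t), this is y (b(y) - β) ≤ 0. At β = b(v) all of this is an equality
(`earlyPayoff_le`, `earlyPayoff_equilibrium`).

For consistency, the event "w wins at a price near p" is, up to the event that both bids are near p,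
the product of "the bid of w is near p" and "the other bid is below p". Hence in the limit δ → 0 the
values are independent. With x = `invBid p`, the loser's value mixes uniform on [0, x] and the prior
with weights (1 - ε)x and εp; the winner's mixes the point mass at x and the prior with weights (1 -
ε)r and ε, where r is the limiting density of equilibrium bids at p. As ε → 0 the prior disappears,
except from the winner's mixture above b(1), where r = 0. -/

/-! ### The bid function of the first auction and its inverse -/

/-- The equilibrium bid in the first auction. -/
def bid (v : ℝ) : ℝ := if v = 0 then 0 else 1 - Real.log (1 + v) / v

@[simp] lemma bid_zero : bid 0 = 0 := by simp [bid]

lemma bid_of_pos {v : ℝ} (hv : 0 < v) : bid v = 1 - Real.log (1 + v) / v := by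
  simp [bid, hv.ne']

lemma bid_one : bid 1 = 1 - Real.log 2 := by
  rw [bid_of_pos one_pos]; norm_num

lemma measurable_bid : Measurable bid := by
  unfold bid
  refine Measurable.ite (measurableSet_singleton 0) measurable_const ?_
  fun_prop

lemma mul_bid {v : ℝ} (hv : 0 ≤ v) : v * bid v = v - Real.log (1 + v) := by
  rcases hv.eq_or_lt with rfl | h
  · simp
  · rw [bid_of_pos h]; field_simp

/-- This is ln s < s - 1 at s = 1/(1 + v); it makes the derivative of `bid` positive. -/
lemma div_one_add_lt_log {v : ℝ} (hv : 0 < v) : v / (1 + v) < Real.log (1 + v) := by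
  have h := Real.log_lt_sub_one_of_pos (x := (1 + v)⁻¹) (by positivity)
    (by rw [ne_eq, inv_eq_one]; linarith)
  rw [Real.log_inv] at h
  have : (1 + v)⁻¹ - 1 = -(v / (1 + v)) := by field_simp; ring
  linarith

lemma bid_nonneg {v : ℝ} (hv : 0 ≤ v) : 0 ≤ bid v := by
  rcases hv.eq_or_lt with rfl | h
  · simp
  · have h1 := Real.log_le_sub_one_of_pos (x := 1 + v) (by positivity)
    rw [bid_of_pos h, sub_nonneg, div_le_one h]
    linarith

lemma bid_le_self {v : ℝ} (hv : 0 ≤ v) : bid v ≤ v := by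
  rcases hv.eq_or_lt with rfl | h
  · simp
  · have h1 := (div_one_add_lt_log h).le
    have h2 : 1 / (1 + v) ≤ Real.log (1 + v) / v := by
      rw [le_div_iff₀ h]; convert h1 using 1; ring
    have h3 : 1 - 1 / (1 + v) ≤ v := by
      rw [sub_le_iff_le_add, ← sub_le_iff_le_add', le_div_iff₀ (by positivity)]
      nlinarith
    rw [bid_of_pos h]
    linarith

lemma bid_lt_one {v : ℝ} (hv : 0 ≤ v) : bid v < 1 := by
  rcases hv.eq_or_lt with rfl | h
  · simp
  · have h1 : 0 < Real.log (1 + v) / v := div_pos (Real.log_pos (by linarith)) h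
    rw [bid_of_pos h]
    linarith

lemma hasDerivAt_bid {v : ℝ} (hv : 0 < v) :
    HasDerivAt bid ((Real.log (1 + v) - v / (1 + v)) / v ^ 2) v := by
  have h1 : HasDerivAt (fun v : ℝ => 1 - Real.log (1 + v) / v)
      (-((1 / (1 + v) * v - Real.log (1 + v) * 1) / v ^ 2)) v :=
    ((((hasDerivAt_id v).const_add 1).log (by simp; positivity)).div (hasDerivAt_id v)
      hv.ne').const_sub 1
  have h2 : bid =ᶠ[𝓝 v] fun v : ℝ => 1 - Real.log (1 + v) / v := by
    filter_upwards [lt_mem_nhds hv] with w hw using bid_of_pos hw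
  refine (h1.congr_of_eventuallyEq h2).congr_deriv ?_
  ring

lemma deriv_bid_pos {v : ℝ} (hv : 0 < v) : 0 < (Real.log (1 + v) - v / (1 + v)) / v ^ 2 :=
  div_pos (sub_pos.2 (div_one_add_lt_log hv)) (by positivity)

lemma continuousOn_bid : ContinuousOn bid (Ici 0) := by
  intro v hv
  rcases (mem_Ici.1 hv).eq_or_lt with rfl | h
  · rw [ContinuousWithinAt, bid_zero]
    refine tendsto_of_tendsto_of_tendsto_of_le_of_le' tendsto_const_nhds
      (tendsto_nhdsWithin_of_tendsto_nhds tendsto_id) ?_ ?_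
    · filter_upwards [self_mem_nhdsWithin] with w hw using bid_nonneg hw
    · filter_upwards [self_mem_nhdsWithin] with w hw using bid_le_self hw
  · exact (hasDerivAt_bid h).continuousAt.continuousWithinAt

lemma strictMonoOn_bid : StrictMonoOn bid (Ici 0) := by
  refine strictMonoOn_of_deriv_pos (convex_Ici 0) continuousOn_bid fun v hv => ?_
  rw [interior_Ici, mem_Ioi] at hv
  rw [(hasDerivAt_bid hv).deriv]
  exact deriv_bid_pos hv

/-! ### The inverse bid function, extended to all real prices -/

/-- The value in `[0, 1]` at which `bid` reaches the price `p`, and `1` for prices above the range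
of `bid`. -/
def invBid (p : ℝ) : ℝ := sSup {x ∈ Icc (0 : ℝ) 1 | bid x ≤ p}

lemma bddAbove_invBid (p : ℝ) : BddAbove {x ∈ Icc (0 : ℝ) 1 | bid x ≤ p} :=
  ⟨1, fun _ hx => hx.1.2⟩

lemma invBid_mem (p : ℝ) : invBid p ∈ Icc (0 : ℝ) 1 :=
  ⟨Real.sSup_nonneg fun _ hx => hx.1.1, Real.sSup_le (fun _ hx => hx.1.2) zero_le_one⟩

/-- Together with `lt_bid_of_invBid_lt` this serves as the inverse relation for every real `p`,
including prices that no value bids. -/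
lemma bid_lt_of_lt_invBid {p v : ℝ} (hv : 0 ≤ v) (h : v < invBid p) : bid v < p := by
  have hne : {x ∈ Icc (0 : ℝ) 1 | bid x ≤ p}.Nonempty := by
    by_contra hne
    rw [not_nonempty_iff_eq_empty] at hne
    rw [invBid, hne, Real.sSup_empty] at h
    linarith
  obtain ⟨x, hx, hvx⟩ := exists_lt_of_lt_csSup hne h
  exact (strictMonoOn_bid (mem_Ici.2 hv) (mem_Ici.2 hx.1.1) hvx).trans_le hx.2

lemma lt_bid_of_invBid_lt {p v : ℝ} (hv : v ≤ 1) (h : invBid p < v) : p < bid v := by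
  by_contra! hp
  exact h.not_ge (le_csSup (bddAbove_invBid p) ⟨⟨(invBid_mem p).1.trans h.le, hv⟩, hp⟩)

/-- A value `z` strictly between `y` and `invBid p` bids strictly on one side of `p`, hence also of
all nearby prices, which keeps their inverse on the correct side of `y`. -/
lemma continuous_invBid : Continuous invBid := by
  refine continuous_iff_continuousAt.2 fun p => tendsto_order.2 ⟨fun y hy => ?_, fun y hy => ?_⟩
  · rcases lt_or_ge y 0 with h0 | h0
    · exact Eventually.of_forall fun q => h0.trans_le (invBid_mem q).1
    · obtain ⟨z, hyz, hz⟩ := exists_between hy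
      filter_upwards [lt_mem_nhds (bid_lt_of_lt_invBid (h0.trans hyz.le) hz)] with q hq
      by_contra! h
      exact (lt_bid_of_invBid_lt (hz.le.trans (invBid_mem p).2) (h.trans_lt hyz)).not_gt hq
  · rcases lt_or_ge 1 y with h1 | h1
    · exact Eventually.of_forall fun q => (invBid_mem q).2.trans_lt h1
    · obtain ⟨z, hz, hzy⟩ := exists_between hy
      filter_upwards [gt_mem_nhds (lt_bid_of_invBid_lt (hzy.le.trans h1) hz)] with q hq
      by_contra! h
      exact (bid_lt_of_lt_invBid ((invBid_mem p).1.trans hz.le) (hzy.trans_le h)).not_gt hq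

lemma invBid_bid {x : ℝ} (hx : x ∈ Icc (0 : ℝ) 1) : invBid (bid x) = x := by
  refine le_antisymm ?_ (le_csSup (bddAbove_invBid _) ⟨hx, le_rfl⟩)
  by_contra! h
  exact (bid_lt_of_lt_invBid hx.1 h).false

lemma invBid_of_bid_one_le {p : ℝ} (hp : bid 1 ≤ p) : invBid p = 1 :=
  le_antisymm (invBid_mem p).2
    (le_csSup (bddAbove_invBid _) ⟨right_mem_Icc.2 zero_le_one, hp⟩)

lemma bid_invBid {p : ℝ} (hp : p ∈ Icc 0 (bid 1)) : bid (invBid p) = p := by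
  obtain ⟨x, hx, rfl⟩ : ∃ x ∈ Icc (0 : ℝ) 1, bid x = p :=
    intermediate_value_Icc zero_le_one (continuousOn_bid.mono Icc_subset_Ici_self)
      (by rwa [bid_zero])
  rw [invBid_bid hx]

lemma bid_invBid_le {p : ℝ} (hp : 0 ≤ p) : bid (invBid p) ≤ p := by
  rcases le_or_gt p (bid 1) with h | h
  · exact (bid_invBid ⟨hp, h⟩).le
  · rw [invBid_of_bid_one_le h.le]; exact h.le

lemma invBid_pos {p : ℝ} (hp : 0 < p) : 0 < invBid p := by
  refine (invBid_mem p).1.lt_of_ne fun h => ?_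
  rcases le_or_gt p (bid 1) with h1 | h1
  · rw [← bid_invBid ⟨hp.le, h1⟩, ← h, bid_zero] at hp
    exact hp.false
  · rw [invBid_of_bid_one_le h1.le] at h
    exact zero_ne_one h

/-! ### Uniform distributions -/

lemma isProbabilityMeasure_uniform {x : ℝ} (hx : 0 < x) : IsProbabilityMeasure (uniform x) :=
  cond_isProbabilityMeasure_of_finite (by simp [hx]) (by simp)

instance : IsProbabilityMeasure (uniform 1) := isProbabilityMeasure_uniform one_pos

lemma ae_mem_uniform (x : ℝ) : ∀ᵐ t ∂uniform x, t ∈ Icc 0 x :=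
  ae_cond_mem measurableSet_Icc

lemma uniform_absolutelyContinuous (x : ℝ) : uniform x ≪ volume :=
  cond_absolutelyContinuous

lemma ae_ne_uniform (x y : ℝ) : ∀ᵐ t ∂uniform x, t ≠ y :=
  (uniform_absolutelyContinuous x).ae_le (Measure.ae_ne volume y)

lemma uniform_real_apply {x : ℝ} (hx : 0 ≤ x) (s : Set ℝ) :
    (uniform x).real s = volume.real (Icc 0 x ∩ s) / x := by
  rw [measureReal_def, uniform, cond_apply measurableSet_Icc, ENNReal.toReal_mul,
    ENNReal.toReal_inv, ← measureReal_def, ← measureReal_def, Real.volume_real_Icc_of_le hx]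
  ring

lemma uniform_one : uniform 1 = volume.restrict (Icc 0 1) := by
  simp [uniform, ProbabilityTheory.cond]

lemma uniform_real_Iio {x y : ℝ} (hy : y ∈ Icc 0 x) : (uniform x).real (Iio y) = y / x := by
  have : Icc 0 x ∩ Iio y = Ico 0 y := by
    ext t; simp only [mem_inter_iff, mem_Icc, mem_Iio, mem_Ico]
    exact ⟨fun h => ⟨h.1.1, h.2⟩, fun h => ⟨⟨h.1, h.2.le.trans hy.2⟩, h.2⟩⟩
  rw [uniform_real_apply (hy.1.trans hy.2), this, Real.volume_real_Ico_of_le hy.1, sub_zero]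

/-! ### Winning probabilities -/

lemma winProb_of_lt {x y : ℝ} (h : y < x) : winProb x y = 1 := by simp [winProb, h]

lemma winProb_of_gt {x y : ℝ} (h : x < y) : winProb x y = 0 := by
  simp [winProb, h.not_gt, h.ne]

lemma winProb_mem (x y : ℝ) : winProb x y ∈ Icc (0 : ℝ) 1 := by
  unfold winProb; split_ifs <;> norm_num

/-- The probability of winning against an opponent with value uniform on `[0, x]` who bids below `β`
up to the value `y` and above `β` from there on. -/
lemma integral_winProb {φ : ℝ → ℝ} {β x y : ℝ} (hy : y ∈ Icc 0 x)
    (hlt : ∀ t ∈ Icc 0 x, t < y → φ t < β) (hgt : ∀ t ∈ Icc 0 x, y < t → β < φ t) :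
    ∫ t, winProb β (φ t) ∂uniform x = y / x := by
  have h : (fun t => winProb β (φ t)) =ᵐ[uniform x] (Iio y).indicator 1 := by
    filter_upwards [ae_mem_uniform x, ae_ne_uniform x y] with t ht hne
    rcases hne.lt_or_gt with h | h
    · rw [winProb_of_lt (hlt t ht h), indicator_of_mem (mem_Iio.2 h), Pi.one_apply]
    · rw [winProb_of_gt (hgt t ht h), indicator_of_notMem (by simpa using h.le)]
  rw [integral_congr_ae h, integral_indicator_one measurableSet_Iio, uniform_real_Iio hy]

/-! ### The second auction -/

/-- The bid of the loser of the first auction, with value `v`, when the values of the loser and of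
the late bidder are uniform on `[0, x]` and `[0, 1]`. -/
def loserBid (x v : ℝ) : ℝ :=
  -- The second branch matters only off the path: a bidder who underbid in the first auction can
  -- lose with a value above `x`, and then makes the top bid.
  if v ≤ x then v / (1 + √(1 - (1 / x ^ 2 - 1) * v ^ 2)) else x / (1 + x)

/-- The bid of the late bidder, with value `v`, when the values of the loser and of the late bidder
are uniform on `[0, x]` and `[0, 1]`. -/
def lateBid (x v : ℝ) : ℝ := v / (1 + √(1 + (1 / x ^ 2 - 1) * v ^ 2))

lemma div_one_add_sqrt_mem {v : ℝ} (hv : v ∈ Icc (0 : ℝ) 1) (s : ℝ) :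
    v / (1 + √s) ∈ Icc (0 : ℝ) 1 := by
  have := Real.sqrt_nonneg s
  exact ⟨div_nonneg hv.1 (by positivity), (div_le_one (by positivity)).2 (by linarith [hv.2])⟩

lemma loserBid_mem {x v : ℝ} (hx : x ∈ Icc (0 : ℝ) 1) (hv : v ∈ Icc (0 : ℝ) 1) :
    loserBid x v ∈ Icc (0 : ℝ) 1 := by
  unfold loserBid
  split_ifs
  · exact div_one_add_sqrt_mem hv _
  · exact ⟨div_nonneg hx.1 (by linarith [hx.1]), (div_le_one (by linarith [hx.1])).2 (by linarith)⟩

lemma lateBid_mem {v : ℝ} (x : ℝ) (hv : v ∈ Icc (0 : ℝ) 1) : lateBid x v ∈ Icc (0 : ℝ) 1 :=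
  div_one_add_sqrt_mem hv _

lemma measurable_loserBid : Measurable (Function.uncurry loserBid) := by
  unfold loserBid Function.uncurry
  refine Measurable.ite (measurableSet_le measurable_snd measurable_fst) ?_ ?_ <;> fun_prop

lemma measurable_lateBid : Measurable (Function.uncurry lateBid) := by
  unfold lateBid Function.uncurry
  fun_prop

section Facts

variable {x : ℝ}

lemma coeff_nonneg (hx : x ∈ Ioc (0 : ℝ) 1) : 0 ≤ 1 / x ^ 2 - 1 := by
  rw [sub_nonneg, one_le_div (pow_pos hx.1 2)]
  exact pow_le_one₀ hx.1.le hx.2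

lemma coeff_mul_sq (hx : x ∈ Ioc (0 : ℝ) 1) : (1 / x ^ 2 - 1) * x ^ 2 = 1 - x ^ 2 := by
  have := hx.1
  field_simp

lemma coeff_mul_top_sq (hx : x ∈ Ioc (0 : ℝ) 1) :
    (1 / x ^ 2 - 1) * (x / (1 + x)) ^ 2 = (1 - x) / (1 + x) := by
  have := hx.1
  field_simp
  ring

/-- The inverse of the bid function of c sends the top bid x/(1 + x) to the value 1, so this bid
beats c almost surely. -/
lemma div_one_sub_coeff_top (hx : x ∈ Ioc (0 : ℝ) 1) :
    2 * (x / (1 + x)) / (1 - (1 - x) / (1 + x)) = 1 := by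
  have := hx.1
  have h : 1 - (1 - x) / (1 + x) = 2 * (x / (1 + x)) := by field_simp; ring
  rw [h, div_self (by positivity)]

lemma coeff_mul_sq_lt_one (hx : x ∈ Ioc (0 : ℝ) 1) {b : ℝ} (hb : b ∈ Icc 0 (x / (1 + x))) :
    (1 / x ^ 2 - 1) * b ^ 2 < 1 := by
  have h0 := hx.1
  calc (1 / x ^ 2 - 1) * b ^ 2 ≤ (1 / x ^ 2 - 1) * (x / (1 + x)) ^ 2 :=
        mul_le_mul_of_nonneg_left (pow_le_pow_left₀ hb.1 hb.2 2) (coeff_nonneg hx)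
    _ = (1 - x) / (1 + x) := coeff_mul_top_sq hx
    _ < 1 := by rw [div_lt_one (by linarith)]; linarith

lemma loserBid_of_le {v : ℝ} (hv : v ≤ x) :
    loserBid x v = v / (1 + √(1 - (1 / x ^ 2 - 1) * v ^ 2)) := if_pos hv

lemma loserBid_of_ge (hx : x ∈ Ioc (0 : ℝ) 1) {v : ℝ} (hv : x ≤ v) :
    loserBid x v = x / (1 + x) := by
  rcases hv.eq_or_lt with rfl | h
  · rw [loserBid_of_le le_rfl, coeff_mul_sq hx, sub_sub_cancel, Real.sqrt_sq hx.1.le]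
  · exact if_neg h.not_ge

lemma loserBid_mem_top (hx : x ∈ Ioc (0 : ℝ) 1) {v : ℝ} (hv : 0 ≤ v) :
    loserBid x v ∈ Icc 0 (x / (1 + x)) := by
  have h0 := hx.1
  rcases le_total x v with h | h
  · rw [loserBid_of_ge hx h]
    exact ⟨by positivity, le_rfl⟩
  · have h1 := mul_le_mul_of_nonneg_left (pow_le_pow_left₀ hv h 2) (coeff_nonneg hx)
    rw [coeff_mul_sq hx] at h1
    have h2 : x ≤ √(1 - (1 / x ^ 2 - 1) * v ^ 2) := Real.le_sqrt_of_sq_le (by linarith)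
    rw [loserBid_of_le h]
    exact ⟨by positivity, div_le_div₀ h0.le h (by positivity) (by linarith)⟩

/-- The inverse of the loser's bid function is `b ↦ 2 b / (1 + k b ^ 2)`. -/
lemma mul_one_add_loserBid (hx : x ∈ Ioc (0 : ℝ) 1) {v : ℝ} (hv : v ∈ Icc 0 x) :
    v * (1 + (1 / x ^ 2 - 1) * loserBid x v ^ 2) = 2 * loserBid x v := by
  have h1 := mul_le_mul_of_nonneg_left (pow_le_pow_left₀ hv.1 hv.2 2) (coeff_nonneg hx)
  rw [coeff_mul_sq hx] at h1
  rw [loserBid_of_le hv.2]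
  generalize 1 / x ^ 2 - 1 = k at *
  have h2 := Real.sq_sqrt (show 0 ≤ 1 - k * v ^ 2 by nlinarith)
  have h3 := Real.sqrt_nonneg (1 - k * v ^ 2)
  generalize √(1 - k * v ^ 2) = s at *
  field_simp
  linear_combination v * h2

lemma lateBid_mem_top (hx : x ∈ Ioc (0 : ℝ) 1) {v : ℝ} (hv : v ∈ Icc (0 : ℝ) 1) :
    lateBid x v ∈ Icc 0 (x / (1 + x)) := by
  have h0 := hx.1
  -- Since v² ≤ 1, v²/x² = v² + kv² ≤ 1 + kv². The bid is then at most xv/(x + v), which is at most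
  -- x/(1 + x).
  have h1 : v / x ≤ √(1 + (1 / x ^ 2 - 1) * v ^ 2) := by
    refine Real.le_sqrt_of_sq_le ?_
    have : (v / x) ^ 2 = 1 / x ^ 2 * v ^ 2 := by ring
    nlinarith [hv.1, hv.2]
  rw [div_le_iff₀ h0] at h1
  refine ⟨div_nonneg hv.1 (by positivity), ?_⟩
  rw [lateBid, div_le_div_iff₀ (by positivity) (by positivity)]
  nlinarith [hv.1, hv.2]

/-- The inverse of the late bidder's bid function is `b ↦ 2 b / (1 - k b ^ 2)`. -/
lemma mul_one_sub_lateBid (hx : x ∈ Ioc (0 : ℝ) 1) (v : ℝ) :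
    v * (1 - (1 / x ^ 2 - 1) * lateBid x v ^ 2) = 2 * lateBid x v := by
  have h1 := coeff_nonneg hx
  rw [lateBid]
  generalize 1 / x ^ 2 - 1 = k at *
  have h2 := Real.sq_sqrt (show 0 ≤ 1 + k * v ^ 2 by positivity)
  have h3 := Real.sqrt_nonneg (1 + k * v ^ 2)
  generalize √(1 + k * v ^ 2) = s at *
  field_simp
  linear_combination v * h2

lemma integral_winProb_loserBid (hx : x ∈ Ioc (0 : ℝ) 1) {β : ℝ} (hβ : β ∈ Icc 0 (x / (1 + x))) :
    ∫ t, winProb β (loserBid x t) ∂uniform x = 2 * β / (1 + (1 / x ^ 2 - 1) * β ^ 2) / x := by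
  have h0 := hx.1
  have hk := coeff_nonneg hx
  have hm := coeff_mul_top_sq hx
  have hmono : ∀ b ∈ Icc 0 (x / (1 + x)), ∀ b' ∈ Icc 0 (x / (1 + x)), b ≤ b' →
      2 * b / (1 + (1 / x ^ 2 - 1) * b ^ 2) ≤ 2 * b' / (1 + (1 / x ^ 2 - 1) * b' ^ 2) := by
    intro b hb b' hb' hbb
    have h2 := coeff_mul_sq_lt_one hx hb'
    generalize 1 / x ^ 2 - 1 = k at *
    rw [div_le_div_iff₀ (by positivity) (by positivity)]
    -- After cross-multiplication the difference is 2(b' - b)(1 - kbb').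
    have : k * (b * b') ≤ k * b' ^ 2 := mul_le_mul_of_nonneg_left (by nlinarith [hb.1]) hk
    nlinarith [mul_nonneg (sub_nonneg.2 hbb) (show 0 ≤ 1 - k * (b * b') by linarith)]
  have hval : ∀ t ∈ Icc 0 x,
      2 * loserBid x t / (1 + (1 / x ^ 2 - 1) * loserBid x t ^ 2) = t := fun t ht => by
    rw [← mul_one_add_loserBid hx ht, mul_div_cancel_right₀ _ (by positivity)]
  have htop : loserBid x x = x / (1 + x) := loserBid_of_ge hx le_rfl
  refine integral_winProb ⟨div_nonneg (by linarith [hβ.1]) (by positivity), ?_⟩ ?_ ?_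
  · have h := hmono β hβ (loserBid x x) (loserBid_mem_top hx h0.le) (htop ▸ hβ.2)
    rwa [hval x ⟨h0.le, le_rfl⟩] at h
  · intro t ht h
    by_contra! hle
    exact h.not_ge ((hmono _ hβ _ (loserBid_mem_top hx ht.1) hle).trans_eq (hval t ht))
  · intro t ht h
    by_contra! hle
    exact h.not_ge ((hval t ht).symm.trans_le (hmono _ (loserBid_mem_top hx ht.1) _ hβ hle))

lemma integral_winProb_lateBid (hx : x ∈ Ioc (0 : ℝ) 1) {β : ℝ} (hβ : β ∈ Icc 0 (x / (1 + x))) :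
    ∫ t, winProb β (lateBid x t) ∂uniform 1 = 2 * β / (1 - (1 / x ^ 2 - 1) * β ^ 2) := by
  have h0 := hx.1
  have hk := coeff_nonneg hx
  have hmono : ∀ b ∈ Icc 0 (x / (1 + x)), ∀ b' ∈ Icc 0 (x / (1 + x)), b ≤ b' →
      2 * b / (1 - (1 / x ^ 2 - 1) * b ^ 2) ≤ 2 * b' / (1 - (1 / x ^ 2 - 1) * b' ^ 2) := by
    intro b hb b' hb' hbb
    refine div_le_div₀ (by linarith [hb'.1]) (by linarith)
      (sub_pos.2 (coeff_mul_sq_lt_one hx hb')) ?_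
    have := mul_le_mul_of_nonneg_left (pow_le_pow_left₀ hb.1 hbb 2) hk
    linarith
  have hval : ∀ t ∈ Icc (0 : ℝ) 1,
      2 * lateBid x t / (1 - (1 / x ^ 2 - 1) * lateBid x t ^ 2) = t := fun t ht => by
    rw [← mul_one_sub_lateBid hx t, mul_div_cancel_right₀ _
      (sub_pos.2 (coeff_mul_sq_lt_one hx (lateBid_mem_top hx ht))).ne']
  have hpos := sub_pos.2 (coeff_mul_sq_lt_one hx hβ)
  have hm : x / (1 + x) ∈ Icc 0 (x / (1 + x)) := ⟨by positivity, le_rfl⟩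
  rw [← div_one (2 * β / _)]
  refine integral_winProb ⟨div_nonneg (by linarith [hβ.1]) hpos.le, ?_⟩ ?_ ?_
  · refine (hmono β hβ _ hm hβ.2).trans ?_
    rw [coeff_mul_top_sq hx, div_one_sub_coeff_top hx]
  · intro t ht h
    by_contra! hle
    exact h.not_ge ((hmono _ hβ _ (lateBid_mem_top hx ht) hle).trans_eq (hval t ht))
  · intro t ht h
    by_contra! hle
    exact h.not_ge ((hval t ht).symm.trans_le (hmono _ (lateBid_mem_top hx ht) _ hβ hle))

/-! ### Best replies in the second auction -/

lemma integral_winProb_of_top_lt {φ : ℝ → ℝ} {y β : ℝ} (hy : 0 < y)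
    (hφ : ∀ t ∈ Icc 0 y, φ t ∈ Icc 0 (x / (1 + x))) (hβ : x / (1 + x) < β) :
    ∫ t, winProb β (φ t) ∂uniform y = 1 := by
  rw [integral_winProb (y := y) ⟨hy.le, le_rfl⟩ (fun t ht _ => (hφ t ht).2.trans_lt hβ)
    (fun t ht h => absurd h ht.2.not_gt), div_self hy.ne']

/-- The equilibrium payoff in the second auction of the loser of the first one. -/
def loserGain (v x : ℝ) : ℝ :=
  ∫ u, winProb (loserBid x v) (lateBid x u) * (v - loserBid x v) ∂uniform 1

lemma loserGain_of_le (hx : x ∈ Ioc (0 : ℝ) 1) {v : ℝ} (hv : v ∈ Icc 0 x) :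
    loserGain v x = v * loserBid x v := by
  have hb := loserBid_mem_top hx hv.1
  have h1 := coeff_mul_sq_lt_one hx hb
  have hk := coeff_nonneg hx
  have h2 := mul_one_add_loserBid hx hv
  rw [loserGain, integral_mul_const, integral_winProb_lateBid hx hb]
  generalize loserBid x v = b at *
  generalize 1 / x ^ 2 - 1 = k at *
  rw [div_mul_eq_mul_div, div_eq_iff (by linarith)]
  linear_combination b * h2

lemma loserGain_of_ge (hx : x ∈ Ioc (0 : ℝ) 1) {v : ℝ} (hv : x ≤ v) :
    loserGain v x = v - x / (1 + x) := by
  have h0 := hx.1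
  have hm : x / (1 + x) ∈ Icc 0 (x / (1 + x)) := ⟨by positivity, le_rfl⟩
  rw [loserGain, integral_mul_const, loserBid_of_ge hx hv, integral_winProb_lateBid hx hm,
    coeff_mul_top_sq hx, div_one_sub_coeff_top hx, one_mul]

/-- Eliminating v through v(1 + kb²) = 2b turns the loss from bidding β instead of b into a square.
-/
lemma loser_payoff_le_of_le (hx : x ∈ Ioc (0 : ℝ) 1) {v : ℝ} (hv : v ∈ Icc 0 x) {β : ℝ}
    (hβ : β ∈ Icc 0 (x / (1 + x))) :
    2 * β / (1 - (1 / x ^ 2 - 1) * β ^ 2) * (v - β) ≤ v * loserBid x v := by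
  have h1 := coeff_mul_sq_lt_one hx hβ
  have hk := coeff_nonneg hx
  have h2 := mul_one_add_loserBid hx hv
  generalize loserBid x v = b at *
  generalize 1 / x ^ 2 - 1 = k at *
  rw [div_mul_eq_mul_div, div_le_iff₀ (by linarith)]
  have h3 : 0 < 1 + k * b ^ 2 := by positivity
  have h4 : (1 + k * b ^ 2) * (v * b * (1 - k * β ^ 2) - 2 * β * (v - β)) = 2 * (b - β) ^ 2 := by
    linear_combination (b * (1 - k * β ^ 2) - 2 * β) * h2
  have h5 := (mul_nonneg_iff_of_pos_left h3).1 (h4 ▸ mul_nonneg zero_le_two (sq_nonneg _))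
  linarith

/-- The bid of the loser is optimal. -/
lemma loser_optimal (hx : x ∈ Ioc (0 : ℝ) 1) {v : ℝ} (hv : 0 ≤ v) {β : ℝ} (hβ : 0 ≤ β) :
    ∫ u, winProb β (lateBid x u) * (v - β) ∂uniform 1 ≤ loserGain v x := by
  have h0 := hx.1
  have hm : x / (1 + x) ∈ Icc 0 (x / (1 + x)) := ⟨by positivity, le_rfl⟩
  have key : ∀ b ∈ Icc 0 (x / (1 + x)),
      ∫ u, winProb b (lateBid x u) * (v - b) ∂uniform 1 ≤ loserGain v x := by
    intro b hb
    rw [integral_mul_const, integral_winProb_lateBid hx hb]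
    rcases le_total v x with h | h
    · rw [loserGain_of_le hx ⟨hv, h⟩]
      exact loser_payoff_le_of_le hx ⟨hv, h⟩ hb
    -- Compared with the value x, a value v ≥ x adds v - x times the winning probability to the
    -- payoff of each bid. The top bid, optimal at x, wins surely and so gains the whole of v - x.
    · have h1 := loser_payoff_le_of_le hx ⟨h0.le, le_rfl⟩ hb
      rw [← loserGain_of_le hx ⟨h0.le, le_rfl⟩, loserGain_of_ge hx le_rfl] at h1
      have h2 : 2 * b / (1 - (1 / x ^ 2 - 1) * b ^ 2) ≤ 1 := by
        rw [← integral_winProb_lateBid hx hb]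
        refine (integral_mono_of_nonneg (Eventually.of_forall fun t => (winProb_mem _ _).1)
          (integrable_const 1) (Eventually.of_forall fun t => (winProb_mem _ _).2)).trans_eq ?_
        simp
      rw [loserGain_of_ge hx h]
      nlinarith [mul_nonneg (sub_nonneg.2 h2) (sub_nonneg.2 h)]
  rcases le_or_gt β (x / (1 + x)) with h | h
  · exact key β ⟨hβ, h⟩
  -- A bid above the top wins no more often than the top bid and costs more.
  · refine le_trans ?_ (key _ hm)
    rw [integral_mul_const, integral_mul_const, integral_winProb_lateBid hx hm,
      integral_winProb_of_top_lt one_pos (fun t ht => lateBid_mem_top hx ht) h, coeff_mul_top_sq hx,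
      div_one_sub_coeff_top hx]
    linarith

/-- The left side is the payoff from the top bid, which beats c surely. This bounds what winning the
first auction can add to losing it. -/
lemma le_loserGain (hx : x ∈ Ioc (0 : ℝ) 1) {v : ℝ} (hv : 0 ≤ v) :
    v - x / (1 + x) ≤ loserGain v x := by
  have h0 := hx.1
  have hm : x / (1 + x) ∈ Icc 0 (x / (1 + x)) := ⟨by positivity, le_rfl⟩
  refine le_trans (le_of_eq ?_) (loser_optimal hx hv hm.1)
  rw [integral_mul_const, integral_winProb_lateBid hx hm, coeff_mul_top_sq hx,
    div_one_sub_coeff_top hx, one_mul]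

/-- The bid of the late bidder is optimal. -/
lemma late_optimal (hx : x ∈ Ioc (0 : ℝ) 1) {v : ℝ} (hv : v ∈ Icc (0 : ℝ) 1) {β : ℝ} (hβ : 0 ≤ β) :
    ∫ t, winProb β (loserBid x t) * (v - β) ∂uniform x
      ≤ ∫ t, winProb (lateBid x v) (loserBid x t) * (v - lateBid x v) ∂uniform x := by
  have h0 := hx.1
  have hm : x / (1 + x) ∈ Icc 0 (x / (1 + x)) := ⟨by positivity, le_rfl⟩
  have hb := lateBid_mem_top hx hv
  have key : ∀ β ∈ Icc 0 (x / (1 + x)), ∫ t, winProb β (loserBid x t) * (v - β) ∂uniform x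
      ≤ ∫ t, winProb (lateBid x v) (loserBid x t) * (v - lateBid x v) ∂uniform x := by
    intro β hβ
    rw [integral_mul_const, integral_mul_const, integral_winProb_loserBid hx hβ,
      integral_winProb_loserBid hx hb, div_mul_eq_mul_div _ x, div_mul_eq_mul_div _ x,
      div_le_div_iff_of_pos_right h0]
    have h1 := coeff_mul_sq_lt_one hx hb
    have hk := coeff_nonneg hx
    have h2 := mul_one_sub_lateBid hx v
    generalize lateBid x v = b at *
    generalize 1 / x ^ 2 - 1 = k at *
    have h3 : 0 < 1 - k * b ^ 2 := by linarith
    have h4 : 2 * b / (1 + k * b ^ 2) * (v - b) = v * b := by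
      rw [div_mul_eq_mul_div, div_eq_iff (by positivity)]
      linear_combination b * h2
    rw [h4, div_mul_eq_mul_div, div_le_iff₀ (by positivity)]
    -- The same square as for the loser, with k replaced by -k.
    have h5 : (1 - k * b ^ 2) * (v * b * (1 + k * β ^ 2) - 2 * β * (v - β)) = 2 * (b - β) ^ 2 := by
      linear_combination (b * (1 + k * β ^ 2) - 2 * β) * h2
    have h6 := (mul_nonneg_iff_of_pos_left h3).1 (h5 ▸ mul_nonneg zero_le_two (sq_nonneg _))
    linarith
  rcases le_or_gt β (x / (1 + x)) with h | h
  · exact key β ⟨hβ, h⟩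
  · refine le_trans ?_ (key _ hm)
    rw [integral_mul_const, integral_mul_const, integral_winProb_loserBid hx hm,
      integral_winProb_of_top_lt h0 (fun t ht => loserBid_mem_top hx ht.1) h, coeff_mul_top_sq hx]
    have : 2 * (x / (1 + x)) / (1 + (1 - x) / (1 + x)) / x = 1 := by field_simp; ring
    rw [this]
    linarith

end Facts

/-! ### The first auction -/

/-- The equilibrium strategies. -/
def equilibriumProfile : StrategyProfile where
  first _ := bid
  loser _ p v := loserBid (invBid p) v
  late _ p v := lateBid (invBid p) v
  measurable_first _ := measurable_bid
  measurable_loser _ := measurable_loserBid.comp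
    ((continuous_invBid.measurable.comp measurable_fst).prodMk measurable_snd)
  measurable_late _ := measurable_lateBid.comp
    ((continuous_invBid.measurable.comp measurable_fst).prodMk measurable_snd)
  first_mem _ _ hv := ⟨bid_nonneg hv.1, (bid_lt_one hv.1).le⟩
  loser_mem _ p _ _ hv := loserBid_mem (invBid_mem p) hv
  late_mem _ _ _ _ hv := lateBid_mem _ hv

lemma integrable_loserGain {v : ℝ} (hv : v ∈ Icc (0 : ℝ) 1) :
    Integrable (loserGain v) (uniform 1) := by
  -- Integrability is read off the closed forms of `loserGain` on the two sides of x = v.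
  have hmeas : Measurable fun x : ℝ => if v ≤ x then v * loserBid x v else v - x / (1 + x) := by
    refine Measurable.ite (measurableSet_le measurable_const measurable_id) ?_ (by fun_prop)
    exact (measurable_loserBid.comp (measurable_id.prodMk measurable_const)).const_mul v
  have hmem : ∀ᵐ x ∂uniform 1, x ∈ Ioc (0 : ℝ) 1 := by
    filter_upwards [ae_mem_uniform 1, ae_ne_uniform 1 0] with x hx h0
      using ⟨lt_of_le_of_ne hx.1 h0.symm, hx.2⟩
  refine (Integrable.of_bound hmeas.aestronglyMeasurable 1 ?_).congr ?_
  · filter_upwards [hmem] with x hx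
    have h1 := loserBid_mem ⟨hx.1.le, hx.2⟩ hv
    have h2 : x / (1 + x) ∈ Icc (0 : ℝ) 1 :=
      ⟨div_nonneg hx.1.le (by linarith [hx.1]), (div_le_one (by linarith [hx.1])).2 (by linarith)⟩
    rw [Real.norm_eq_abs, abs_le]
    split_ifs
    · exact ⟨by nlinarith [mul_nonneg hv.1 h1.1], mul_le_one₀ hv.2 h1.1 h1.2⟩
    · exact ⟨by linarith [hv.1, h2.2], by linarith [hv.2, h2.1]⟩
  · filter_upwards [hmem] with x hx
    split_ifs with h
    · exact (loserGain_of_le hx ⟨hv.1, h⟩).symm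
    · exact (loserGain_of_ge hx (not_le.1 h).le).symm

lemma loserGain_nonneg {x : ℝ} (hx : x ∈ Ioc (0 : ℝ) 1) {v : ℝ} (hv : 0 ≤ v) :
    0 ≤ loserGain v x := by
  refine le_trans (integral_nonneg fun u => ?_) (loser_optimal hx hv le_rfl)
  exact mul_nonneg (winProb_mem _ _).1 (by simpa using hv)

/-- This identity determines the first bid: b(y) is the average over t < y of the price t/(1 + t) at
which the second item could be bought for sure. An antiderivative is t - ln(1 + t). -/
lemma integral_indicator_div_one_add {y : ℝ} (hy : y ∈ Icc (0 : ℝ) 1) :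
    ∫ t, (Iio y).indicator (fun t => t / (1 + t)) t ∂uniform 1 = y * bid y := by
  have h1 : Iio y ∩ Icc 0 1 = Ico 0 y := by
    ext t; simp only [mem_inter_iff, mem_Icc, mem_Iio, mem_Ico]
    exact ⟨fun h => ⟨h.2.1, h.1⟩, fun h => ⟨h.2, h.1, h.2.le.trans hy.2⟩⟩
  rw [uniform_one, integral_indicator measurableSet_Iio, Measure.restrict_restrict measurableSet_Iio,
    h1, integral_Ico_eq_integral_Ioc, ← intervalIntegral.integral_of_le hy.1, mul_bid hy.1]
  have hpos : ∀ t ∈ uIcc 0 y, (0 : ℝ) < 1 + t := fun t ht => by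
    rw [uIcc_of_le hy.1] at ht; linarith [ht.1]
  rw [intervalIntegral.integral_eq_sub_of_hasDerivAt (f := fun t => t - Real.log (1 + t))]
  · simp
  · intro t ht
    refine ((hasDerivAt_id t).sub (((hasDerivAt_id t).const_add 1).log
      (hpos t ht).ne')).congr_deriv ?_
    have := (hpos t ht).ne'
    simp only [id]
    field_simp
    ring
  · exact (continuousOn_id.div (by fun_prop) fun t ht => (hpos t ht).ne').intervalIntegrable

lemma integral_loserGain_add {v : ℝ} (hv : v ∈ Icc (0 : ℝ) 1) {y : ℝ} (hy : y ∈ Icc (0 : ℝ) 1)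
    (β : ℝ) :
    Integrable (fun t => loserGain v t + (Iio y).indicator (fun t => t / (1 + t) - β) t)
      (uniform 1) ∧
    ∫ t, loserGain v t + (Iio y).indicator (fun t => t / (1 + t) - β) t ∂uniform 1
      = ∫ t, loserGain v t ∂uniform 1 + y * (bid y - β) := by
  have h1 : Integrable ((Iio y).indicator fun t : ℝ => t / (1 + t)) (uniform 1) := by
    have hmeas : Measurable fun t : ℝ => t / (1 + t) := by fun_prop
    refine Integrable.indicator (Integrable.of_bound hmeas.aestronglyMeasurable 1 ?_)
      measurableSet_Iio
    filter_upwards [ae_mem_uniform 1] with t ht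
    have h0 : 0 ≤ t / (1 + t) := div_nonneg ht.1 (by linarith [ht.1])
    rw [Real.norm_of_nonneg h0]
    exact (div_le_one (by linarith [ht.1])).2 (by linarith)
  have h2 : Integrable ((Iio y).indicator fun _ : ℝ => β) (uniform 1) :=
    (integrable_const β).indicator measurableSet_Iio
  have h3 : (Iio y).indicator (fun t => t / (1 + t) - β)
      = fun t => (Iio y).indicator (fun t : ℝ => t / (1 + t)) t
        - (Iio y).indicator (fun _ => β) t := indicator_sub' _ _ _
  rw [h3]
  refine ⟨(integrable_loserGain hv).add (h1.sub h2), ?_⟩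
  refine (integral_add (integrable_loserGain hv) (h1.sub h2)).trans ?_
  congr 1
  refine (integral_sub h1 h2).trans ?_
  rw [integral_indicator_div_one_add hy, integral_indicator_const _ measurableSet_Iio,
    uniform_real_Iio hy, div_one, smul_eq_mul]
  ring

/-- Pointwise in t, winning is bounded through `le_loserGain` and losing through `loser_optimal`,
whatever the plan `d` is. -/
lemma earlyPayoff_le (i : Early) {v : ℝ} (hv : v ∈ Icc (0 : ℝ) 1) {β : ℝ}
    (hβ : 0 ≤ β) {d : ℝ → ℝ} (hd : ∀ p ∈ Icc (0 : ℝ) 1, d p ∈ Icc (0 : ℝ) 1) :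
    earlyPayoff equilibriumProfile i v β d ≤ ∫ t, loserGain v t ∂uniform 1 := by
  unfold earlyPayoff
  -- A non-integrable payoff has integral 0 by convention, and 0 is at most the integral of the
  -- nonnegative `loserGain v`.
  by_cases hint : Integrable (fun t => winProb β (equilibriumProfile.first i.other t) * (v - β)
      + winProb (equilibriumProfile.first i.other t) β *
        ∫ u, winProb (d (equilibriumProfile.first i.other t))
          (equilibriumProfile.late i.other (equilibriumProfile.first i.other t) u)
          * (v - d (equilibriumProfile.first i.other t)) ∂(uniform 1)) (uniform 1)
  · obtain ⟨h1, h2⟩ := integral_loserGain_add hv (invBid_mem β) β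
    refine (integral_mono_ae hint h1 ?_).trans (h2.trans_le ?_)
    · filter_upwards [ae_mem_uniform 1, ae_ne_uniform 1 0, ae_ne_uniform 1 (invBid β)]
        with t ht h0 hne
      have ht' : t ∈ Ioc (0 : ℝ) 1 := ⟨lt_of_le_of_ne ht.1 h0.symm, ht.2⟩
      simp only [equilibriumProfile]
      rcases hne.lt_or_gt with h | h
      · have hb := bid_lt_of_lt_invBid ht.1 h
        rw [winProb_of_lt hb, winProb_of_gt hb, indicator_of_mem (mem_Iio.2 h)]
        linarith [le_loserGain ht' hv.1]
      · have hb := lt_bid_of_invBid_lt ht.2 h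
        rw [winProb_of_gt hb, winProb_of_lt hb, indicator_of_notMem (by simpa using h.le),
          invBid_bid ht, zero_mul, zero_add, one_mul, add_zero]
        exact loser_optimal ht' hv.1 (hd _ ⟨bid_nonneg ht.1, (bid_lt_one ht.1).le⟩).1
    -- The correction y (b(y) - β) is nonpositive, as y = `invBid β` bids at most β.
    · nlinarith [mul_nonneg (invBid_mem β).1 (sub_nonneg.2 (bid_invBid_le hβ))]
  · rw [integral_undef hint]
    refine integral_nonneg_of_ae ?_
    filter_upwards [ae_mem_uniform 1, ae_ne_uniform 1 0] with t ht h0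
      using loserGain_nonneg ⟨lt_of_le_of_ne ht.1 h0.symm, ht.2⟩ hv.1

/-- The bid b(v) beats exactly the values t < v up to a null set, where `loserGain_of_ge` makes the
bound exact, and the correction v (b(v) - b(v)) vanishes. -/
lemma earlyPayoff_equilibrium (i : Early) {v : ℝ} (hv : v ∈ Icc (0 : ℝ) 1) :
    earlyPayoff equilibriumProfile i v (bid v) (fun p => loserBid (invBid p) v)
      = ∫ t, loserGain v t ∂uniform 1 := by
  have h2 := (integral_loserGain_add hv hv (bid v)).2
  rw [sub_self, mul_zero, add_zero] at h2
  rw [← h2]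
  refine integral_congr_ae ?_
  filter_upwards [ae_mem_uniform 1, ae_ne_uniform 1 0, ae_ne_uniform 1 v] with t ht h0 hne
  have ht' : t ∈ Ioc (0 : ℝ) 1 := ⟨lt_of_le_of_ne ht.1 h0.symm, ht.2⟩
  simp only [equilibriumProfile]
  rcases hne.lt_or_gt with h | h
  · have hb := strictMonoOn_bid (mem_Ici.2 ht.1) (mem_Ici.2 hv.1) h
    rw [winProb_of_lt hb, winProb_of_gt hb, indicator_of_mem (mem_Iio.2 h),
      loserGain_of_ge ht' h.le]
    ring
  · have hb := strictMonoOn_bid (mem_Ici.2 hv.1) (mem_Ici.2 ht.1) h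
    rw [winProb_of_gt hb, winProb_of_lt hb, indicator_of_notMem (by simpa using h.le),
      invBid_bid ht, zero_mul, zero_add, one_mul, add_zero]
    rfl

/-! ### The density of the equilibrium bids -/

lemma preimage_bid_ball_ae (p δ : ℝ) :
    ({v | |bid v - p| < δ} : Set ℝ) =ᵐ[uniform 1] Ioo (invBid (p - δ)) (invBid (p + δ)) := by
  filter_upwards [ae_mem_uniform 1, ae_ne_uniform 1 (invBid (p - δ)),
    ae_ne_uniform 1 (invBid (p + δ))] with t ht h1 h2
  refine propext ?_
  change |bid t - p| < δ ↔ invBid (p - δ) < t ∧ t < invBid (p + δ)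
  rw [abs_lt]
  constructor
  · rintro ⟨h3, h4⟩
    constructor
    · by_contra! h
      linarith [bid_lt_of_lt_invBid ht.1 (h.lt_of_ne h1)]
    · by_contra! h
      linarith [lt_bid_of_invBid_lt ht.2 (h.lt_of_ne h2.symm)]
  · rintro ⟨h3, h4⟩
    constructor <;> linarith [lt_bid_of_invBid_lt ht.2 h3, bid_lt_of_lt_invBid ht.1 h4]

lemma invBid_mono : Monotone invBid := by
  intro p q hpq
  by_contra! h
  obtain ⟨z, h1, h2⟩ := exists_between h
  have h3 := bid_lt_of_lt_invBid ((invBid_mem q).1.trans h1.le) h2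
  have h4 := lt_bid_of_invBid_lt (h2.le.trans (invBid_mem p).2) h1
  linarith

lemma uniform_real_Ioo {a b : ℝ} (ha : 0 ≤ a) (hab : a ≤ b) (hb : b ≤ 1) :
    (uniform 1).real (Ioo a b) = b - a := by
  have : Icc 0 1 ∩ Ioo a b = Ioo a b :=
    inter_eq_right.2 fun t ht => ⟨ha.trans ht.1.le, ht.2.le.trans hb⟩
  rw [uniform_real_apply zero_le_one, this, Real.volume_real_Ioo_of_le hab, div_one]

lemma uniform_real_preimage_bid_ball (p : ℝ) {δ : ℝ} (hδ : 0 ≤ δ) :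
    (uniform 1).real {v | |bid v - p| < δ} = invBid (p + δ) - invBid (p - δ) := by
  rw [measureReal_congr (preimage_bid_ball_ae p δ),
    uniform_real_Ioo (invBid_mem _).1 (invBid_mono (by linarith)) (invBid_mem _).2]

lemma abs_sub_lt_eq_Ioo (p δ : ℝ) : {s : ℝ | |s - p| < δ} = Ioo (p - δ) (p + δ) := by
  ext s
  rw [mem_ofPred_eq, abs_lt, mem_Ioo, neg_lt_sub_iff_lt_add, sub_lt_iff_lt_add, add_comm δ,
    sub_lt_iff_lt_add, add_comm δ]

/-- These difference quotients are reciprocals of those of `bid` at x along `invBid (q δ)`, which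
tends to x without reaching it. -/
lemma tendsto_slope_invBid {x : ℝ} (hx : x ∈ Ioc (0 : ℝ) 1) {q : ℝ → ℝ} {l : Filter ℝ}
    (hq : Tendsto q l (𝓝 (bid x))) (hne : ∀ᶠ δ in l, q δ ≠ bid x)
    (hmem : ∀ᶠ δ in l, q δ ∈ Icc 0 (bid 1)) :
    Tendsto (fun δ => (invBid (q δ) - x) / (q δ - bid x)) l
      (𝓝 ((Real.log (1 + x) - x / (1 + x)) / x ^ 2)⁻¹) := by
  have h1 : Tendsto (fun δ => invBid (q δ)) l (𝓝[≠] x) := by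
    refine tendsto_nhdsWithin_iff.2 ⟨?_, ?_⟩
    · have := (continuous_invBid.tendsto (bid x)).comp hq
      rwa [invBid_bid ⟨hx.1.le, hx.2⟩] at this
    · filter_upwards [hne, hmem] with δ h h' heq
      rw [mem_singleton_iff] at heq
      rw [← bid_invBid h', heq] at h
      exact h rfl
  have h2 := ((hasDerivAt_iff_tendsto_slope.1 (hasDerivAt_bid hx.1)).comp h1).inv₀
    (deriv_bid_pos hx.1).ne'
  refine h2.congr' ?_
  filter_upwards [hmem] with δ h
  rw [Function.comp_apply, slope_def_field, inv_div, bid_invBid h]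

/-- The ratio of the probabilities that a bid near `p` is an equilibrium bid and that it is a
uniformly random one converges, and its limit is positive in the range of the equilibrium bids. -/
lemma exists_tendsto_density {p : ℝ} (hp : p ∈ Ioc (0 : ℝ) 1) :
    ∃ r : ℝ, 0 ≤ r ∧ (p ≤ bid 1 → 0 < r) ∧ (bid 1 < p → r = 0) ∧
      Tendsto (fun δ => (uniform 1).real {v | |bid v - p| < δ} / (uniform 1).real {s | |s - p| < δ})
        (𝓝[>] 0) (𝓝 r) := by
  rcases lt_or_ge (bid 1) p with h1 | h1
  · refine ⟨0, le_rfl, fun h => absurd h h1.not_ge, fun _ => rfl, ?_⟩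
    refine tendsto_const_nhds.congr' ?_
    have h2 : ∀ᶠ δ : ℝ in 𝓝[>] 0, δ < p - bid 1 :=
      nhdsWithin_le_nhds (gt_mem_nhds (sub_pos.2 h1))
    filter_upwards [h2, self_mem_nhdsWithin] with δ h2 h3
    rw [mem_Ioi] at h3
    rw [uniform_real_preimage_bid_ball p h3.le, invBid_of_bid_one_le (by linarith),
      invBid_of_bid_one_le (by linarith), sub_self, zero_div]
  · have hx : invBid p ∈ Ioc (0 : ℝ) 1 := ⟨invBid_pos hp.1, (invBid_mem p).2⟩
    have hbx := bid_invBid ⟨hp.1.le, h1⟩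
    set x := invBid p with hxdef
    clear_value x
    subst hbx
    have hc := deriv_bid_pos hx.1
    set c := (Real.log (1 + x) - x / (1 + x)) / x ^ 2
    have hpos : ∀ᶠ δ : ℝ in 𝓝[>] 0, 0 < δ := self_mem_nhdsWithin
    have hid : Tendsto (fun δ : ℝ => δ) (𝓝[>] 0) (𝓝 0) := tendsto_nhdsWithin_of_tendsto_nhds tendsto_id
    have hsmall : ∀ a : ℝ, 0 < a → ∀ᶠ δ : ℝ in 𝓝[>] 0, δ < a := fun a ha =>
      nhdsWithin_le_nhds (gt_mem_nhds ha)
    have hleft : Tendsto (fun δ => (x - invBid (bid x - δ)) / δ) (𝓝[>] 0) (𝓝 c⁻¹) := by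
      have := tendsto_slope_invBid hx (q := fun δ => bid x - δ) (l := 𝓝[>] 0)
        (by simpa using hid.const_sub (bid x))
        (by filter_upwards [hpos] with δ h; simpa using h.ne')
        (by filter_upwards [hpos, hsmall _ hp.1] with δ h h'; constructor <;> linarith)
      refine this.congr fun δ => ?_
      rw [sub_sub_cancel_left, div_neg, ← neg_div, neg_sub]
    -- The two sides of the price are treated separately: at b(1) there are no equilibrium bids
    -- above, so the right slope is 0, but the left one keeps the limit positive.
    obtain ⟨l, hl0, hright⟩ : ∃ l : ℝ, 0 ≤ l ∧
        Tendsto (fun δ => (invBid (bid x + δ) - x) / δ) (𝓝[>] 0) (𝓝 l) := by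
      rcases hx.2.eq_or_lt with rfl | hlt
      · refine ⟨0, le_rfl, tendsto_const_nhds.congr' ?_⟩
        filter_upwards [hpos] with δ h
        rw [invBid_of_bid_one_le (by linarith), sub_self, zero_div]
      · have hlt' := strictMonoOn_bid (mem_Ici.2 hx.1.le) (mem_Ici.2 zero_le_one) hlt
        refine ⟨c⁻¹, (inv_pos.2 hc).le, ?_⟩
        have := tendsto_slope_invBid hx (q := fun δ => bid x + δ) (l := 𝓝[>] 0)
          (by simpa using hid.const_add (bid x))
          (by filter_upwards [hpos] with δ h; simpa using h.ne')
          (by filter_upwards [hpos, hsmall _ (sub_pos.2 hlt')] with δ h h'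
              constructor <;> linarith [hp.1])
        refine this.congr fun δ => ?_
        rw [add_sub_cancel_left]
    refine ⟨(l + c⁻¹) / 2, by positivity, fun _ => by positivity, fun h => absurd h h1.not_gt, ?_⟩
    refine ((hright.add hleft).div_const 2).congr' ?_
    filter_upwards [hpos, hsmall _ hp.1, hsmall _ (sub_pos.2 (bid_lt_one hx.1.le))] with δ h h' h''
    rw [uniform_real_preimage_bid_ball _ h.le, abs_sub_lt_eq_Ioo,
      uniform_real_Ioo (by linarith) (by linarith) (by linarith)]
    have h2 : bid x + δ - (bid x - δ) = 2 * δ := by ring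
    rw [h2]
    field_simp
    ring

lemma uniform_real_ball_pos {p : ℝ} (hp : p ∈ Ioc (0 : ℝ) 1) {δ : ℝ} (hδ : 0 < δ) :
    0 < (uniform 1).real {s | |s - p| < δ} := by
  have hmax : max 0 (p - δ) < p := max_lt hp.1 (by linarith)
  have h1 : (uniform 1).real (Ioo (max 0 (p - δ)) p) = p - max 0 (p - δ) :=
    uniform_real_Ioo (le_max_left _ _) hmax.le hp.2
  refine (sub_pos.2 hmax).trans_le (h1 ▸ measureReal_mono ?_)
  rw [abs_sub_lt_eq_Ioo]
  exact Ioo_subset_Ioo (le_max_right _ _) (by linarith)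

lemma tendsto_uniform_real_ball (p : ℝ) :
    Tendsto (fun δ => (uniform 1).real {s | |s - p| < δ}) (𝓝[>] 0) (𝓝 0) := by
  have h1 : Tendsto (fun δ : ℝ => 2 * δ) (𝓝[>] 0) (𝓝 0) :=
    tendsto_nhdsWithin_of_tendsto_nhds (by simpa using (continuous_const_mul (2 : ℝ)).tendsto 0)
  refine tendsto_of_tendsto_of_tendsto_of_le_of_le' tendsto_const_nhds h1
    (Eventually.of_forall fun _ => measureReal_nonneg) ?_
  filter_upwards [self_mem_nhdsWithin] with δ hδ
  rw [mem_Ioi] at hδ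
  rw [uniform_real_apply zero_le_one, div_one, abs_sub_lt_eq_Ioo]
  refine (measureReal_mono inter_subset_right (by simp)).trans_eq ?_
  rw [Real.volume_real_Ioo_of_le (by linarith)]
  ring

/-- The values bidding near p form, up to null sets, intervals shrinking to `invBid p`, on which the
continuous g is nearly constant. Nothing is divided by their mass, so r = 0 is allowed. -/
lemma tendsto_setIntegral_density {p r : ℝ}
    (hr : Tendsto (fun δ => (uniform 1).real {v | |bid v - p| < δ}
      / (uniform 1).real {s | |s - p| < δ}) (𝓝[>] 0) (𝓝 r)) {g : ℝ → ℝ} (hg : Continuous g) :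
    Tendsto (fun δ => (∫ v in {v | |bid v - p| < δ}, g v ∂uniform 1)
      / (uniform 1).real {s | |s - p| < δ}) (𝓝[>] 0) (𝓝 (r * g (invBid p))) := by
  have hs : Tendsto (fun δ => Ioo (invBid (p - δ)) (invBid (p + δ))) (𝓝[>] 0)
      (𝓝 (invBid p)).smallSets := by
    refine Tendsto.Ioo (l₁ := 𝓝 (invBid p)) ?_ ?_ <;>
    refine tendsto_nhdsWithin_of_tendsto_nhds ?_
    · have : Continuous fun δ => invBid (p - δ) := continuous_invBid.comp (by fun_prop)
      simpa using this.tendsto 0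
    · have : Continuous fun δ => invBid (p + δ) := continuous_invBid.comp (by fun_prop)
      simpa using this.tendsto 0
  have h1 := (hg.tendsto (invBid p)).mono_left (inf_le_left (b := ae (uniform 1)))
  have h2 := (h1.integral_sub_linear_isLittleO_ae
    hg.stronglyMeasurable.stronglyMeasurableAtFilter
    (Measure.finiteAt_nhds _ _) hs (fun δ => (uniform 1).real {v | |bid v - p| < δ})
    (Eventually.of_forall fun δ => (measureReal_congr (preimage_bid_ball_ae p δ)).symm))
  have h3 := (h2.mul_isBigO (Asymptotics.isBigO_refl
    (fun δ => ((uniform 1).real {s | |s - p| < δ})⁻¹) (𝓝[>] 0))).trans_isBigO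
    (hr.isBigO_one ℝ)
  have h4 := (Asymptotics.isLittleO_one_iff ℝ).1 h3
  have h5 := h4.add (hr.mul_const (g (invBid p)))
  rw [zero_add] at h5
  refine h5.congr fun δ => ?_
  rw [setIntegral_congr_set (preimage_bid_ball_ae p δ), smul_eq_mul]
  ring

/-! ### Mixtures -/

/-- The mixture `t μ + (1 - t) ν`. -/
def mixture (t : unitInterval) (μ ν : ProbabilityMeasure ℝ) : ProbabilityMeasure ℝ :=
  ⟨ENNReal.ofReal t • (μ : Measure ℝ) + ENNReal.ofReal (1 - t) • (ν : Measure ℝ), ⟨by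
    simp only [Measure.coe_add, Measure.coe_smul, Pi.add_apply, Pi.smul_apply, measure_univ,
      smul_eq_mul, mul_one]
    rw [← ENNReal.ofReal_add t.2.1 (sub_nonneg.2 t.2.2), add_sub_cancel, ENNReal.ofReal_one]⟩⟩

lemma coe_mixture (t : unitInterval) (μ ν : ProbabilityMeasure ℝ) :
    (mixture t μ ν : Measure ℝ)
      = ENNReal.ofReal t • (μ : Measure ℝ) + ENNReal.ofReal (1 - t) • (ν : Measure ℝ) := rfl

lemma integral_ofReal_smul_add {α : Type*} [MeasurableSpace α] {μ ν : Measure α} {a b : ℝ}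
    (ha : 0 ≤ a) (hb : 0 ≤ b) {f : α → ℝ} (hμ : Integrable f μ) (hν : Integrable f ν) :
    ∫ x, f x ∂(ENNReal.ofReal a • μ + ENNReal.ofReal b • ν)
      = a * ∫ x, f x ∂μ + b * ∫ x, f x ∂ν := by
  rw [integral_add_measure (hμ.smul_measure ENNReal.ofReal_ne_top)
    (hν.smul_measure ENNReal.ofReal_ne_top), integral_smul_measure, integral_smul_measure,
    ENNReal.toReal_ofReal ha, ENNReal.toReal_ofReal hb, smul_eq_mul, smul_eq_mul]

lemma integral_mixture (t : unitInterval) (μ ν : ProbabilityMeasure ℝ) (f : ℝ →ᵇ ℝ) :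
    ∫ x, f x ∂(mixture t μ ν : Measure ℝ)
      = t * ∫ x, f x ∂(μ : Measure ℝ) + (1 - t) * ∫ x, f x ∂(ν : Measure ℝ) :=
  integral_ofReal_smul_add t.2.1 (sub_nonneg.2 t.2.2) (f.integrable _) (f.integrable _)

lemma tendsto_mixture {ι : Type*} {l : Filter ι} {t : ι → unitInterval} {t₀ : unitInterval}
    (ht : Tendsto t l (𝓝 t₀)) (μ ν : ProbabilityMeasure ℝ) :
    Tendsto (fun i => mixture (t i) μ ν) l (𝓝 (mixture t₀ μ ν)) := by
  rw [ProbabilityMeasure.tendsto_iff_forall_integral_tendsto]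
  intro f
  simp only [integral_mixture]
  have h := (continuous_subtype_val.tendsto t₀).comp ht
  exact (h.mul_const _).add ((h.const_sub 1).mul_const _)

lemma mixture_one (μ ν : ProbabilityMeasure ℝ) : mixture 1 μ ν = μ := by
  apply Subtype.ext
  change (mixture 1 μ ν : Measure ℝ) = μ
  simp [coe_mixture]

lemma mixture_zero (μ ν : ProbabilityMeasure ℝ) : mixture 0 μ ν = ν := by
  apply Subtype.ext
  change (mixture 0 μ ν : Measure ℝ) = ν
  simp [coe_mixture]

/-- The share of `a` in `a + b`. -/
def share (a b : ℝ) : unitInterval := projIcc 0 1 zero_le_one (a / (a + b))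

lemma coe_share {a b : ℝ} (ha : 0 ≤ a) (hb : 0 < b) : (share a b : ℝ) = a / (a + b) := by
  rw [share, projIcc_of_mem]
  exact ⟨by positivity, (div_le_one (by positivity)).2 (by linarith)⟩

lemma share_zero (b : ℝ) : share 0 b = 0 := by
  rw [share, zero_div, projIcc_left]
  rfl

lemma tendsto_share {r q : ℝ} (hr : 0 < r) :
    Tendsto (fun ε : ℝ => share ((1 - ε) * r) (ε * q)) (𝓝[>] 0) (𝓝 1) := by
  have h1 : ContinuousAt (fun ε : ℝ => (1 - ε) * r / ((1 - ε) * r + ε * q)) 0 := by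
    refine ContinuousAt.div (by fun_prop) (by fun_prop) ?_
    simpa using hr.ne'
  have h2 : Tendsto (fun ε : ℝ => (1 - ε) * r / ((1 - ε) * r + ε * q)) (𝓝[>] 0) (𝓝 1) := by
    have := h1.tendsto
    simp only [sub_zero, one_mul, zero_mul, add_zero, div_self hr.ne'] at this
    exact tendsto_nhdsWithin_of_tendsto_nhds this
  have h3 := (continuous_projIcc (h := zero_le_one (α := ℝ))).tendsto 1 |>.comp h2
  rw [projIcc_right] at h3
  exact h3

lemma integral_mixture_share {a b : ℝ} (ha : 0 ≤ a) (hb : 0 < b)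
    (μ ν : ProbabilityMeasure ℝ) (f : ℝ →ᵇ ℝ) :
    ∫ x, f x ∂(mixture (share a b) μ ν : Measure ℝ)
      = (a * ∫ x, f x ∂(μ : Measure ℝ) + b * ∫ x, f x ∂(ν : Measure ℝ)) / (a + b) := by
  have : a + b ≠ 0 := by positivity
  rw [integral_mixture, coe_share ha hb]
  field_simp
  ring

lemma ofReal_smul_mixture_share {a b : ℝ} (ha : 0 ≤ a) (hb : 0 < b)
    (μ ν : ProbabilityMeasure ℝ) :
    ENNReal.ofReal (a + b) • (mixture (share a b) μ ν : Measure ℝ)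
      = ENNReal.ofReal a • (μ : Measure ℝ) + ENNReal.ofReal b • (ν : Measure ℝ) := by
  have h0 : a + b ≠ 0 := by positivity
  have h1 : (a + b) * (a / (a + b)) = a := by field_simp
  have h2 : (a + b) * (1 - a / (a + b)) = b := by field_simp; ring
  rw [coe_mixture, smul_add, smul_smul, smul_smul, ← ENNReal.ofReal_mul (by positivity),
    ← ENNReal.ofReal_mul (by positivity), coe_share ha hb, h1, h2]

/-! ### Perturbed bidders -/

/-- The uniform distribution as an element of the space of probability measures; for `x ≤ 0` it is
replaced by that on `[0, 1]`. -/
def uniformPM (x : ℝ) : ProbabilityMeasure ℝ :=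
  ⟨uniform (if 0 < x then x else 1), isProbabilityMeasure_uniform (by split_ifs <;> linarith)⟩

lemma coe_uniformPM {x : ℝ} (hx : 0 < x) : (uniformPM x : Measure ℝ) = uniform x := by
  change uniform (if 0 < x then x else 1) = uniform x
  rw [if_pos hx]

lemma isProbabilityMeasure_perturbedBidder {ε : ℝ} (hε : ε ∈ Icc (0 : ℝ) 1) {s : ℝ → ℝ}
    (hs : Measurable s) : IsProbabilityMeasure (perturbedBidder ε s) := by
  have : IsProbabilityMeasure ((uniform 1).map fun v => (v, s v)) :=
    Measure.isProbabilityMeasure_map (measurable_id.prodMk hs).aemeasurable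
  refine ⟨?_⟩
  simp only [perturbedBidder, Measure.coe_add, Measure.coe_smul, Pi.add_apply, Pi.smul_apply,
    measure_univ, smul_eq_mul, mul_one]
  rw [← ENNReal.ofReal_add (sub_nonneg.2 hε.2) hε.1, sub_add_cancel, ENNReal.ofReal_one]

/-- The law of the value of a perturbed bidder on the event that the bid is in `T`. -/
lemma map_fst_restrict_perturbedBidder (ε : ℝ) {s : ℝ → ℝ} (hs : Measurable s) {T : Set ℝ}
    (hT : MeasurableSet T) :
    ((perturbedBidder ε s).restrict (Prod.snd ⁻¹' T)).map Prod.fst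
      = ENNReal.ofReal (1 - ε) • (uniform 1).restrict (s ⁻¹' T)
        + (ENNReal.ofReal ε * uniform 1 T) • uniform 1 := by
  ext A hA
  have h1 : MeasurableSet (Prod.fst ⁻¹' A ∩ Prod.snd ⁻¹' T : Set (ℝ × ℝ)) :=
    (measurable_fst hA).inter (measurable_snd hT)
  have h2 : (Prod.fst ⁻¹' A ∩ Prod.snd ⁻¹' T : Set (ℝ × ℝ)) = A ×ˢ T := rfl
  rw [Measure.map_apply measurable_fst hA, Measure.restrict_apply (measurable_fst hA),
    perturbedBidder]
  simp only [Measure.coe_add, Measure.coe_smul, Pi.add_apply, Pi.smul_apply, smul_eq_mul]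
  have hgraph : Measurable fun v => (v, s v) := measurable_id.prodMk hs
  rw [Measure.map_apply hgraph h1, Measure.restrict_apply hA, h2,
    Measure.prod_prod]
  congr 1
  rw [mul_assoc, mul_comm (uniform 1 A)]

lemma restrict_bid_preimage_Iio {p : ℝ} (hp : 0 < p) :
    (uniform 1).restrict (bid ⁻¹' Iio p)
      = ENNReal.ofReal (invBid p) • uniform (invBid p) := by
  have hx := invBid_pos hp
  have h1 : bid ⁻¹' Iio p =ᵐ[uniform 1] Icc 0 (invBid p) := by
    filter_upwards [ae_mem_uniform 1, ae_ne_uniform 1 (invBid p)] with t ht hne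
    refine propext ?_
    change bid t < p ↔ 0 ≤ t ∧ t ≤ invBid p
    constructor
    · intro h
      refine ⟨ht.1, ?_⟩
      by_contra! h'
      exact (lt_bid_of_invBid_lt ht.2 h').not_gt h
    · exact fun h => bid_lt_of_lt_invBid ht.1 (h.2.lt_of_ne hne)
  rw [Measure.restrict_congr_set h1, uniform_one, Measure.restrict_restrict measurableSet_Icc,
    inter_eq_left.2 (Icc_subset_Icc_right (invBid_mem p).2), uniform, ProbabilityTheory.cond,
    smul_smul, Real.volume_Icc, sub_zero, ENNReal.mul_inv_cancel (by simpa using hx)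
    ENNReal.ofReal_ne_top, one_smul]

/-- The total mass (1 - ε) `invBid p` + εp is the probability of a bid below p. The mixture is exact
for each ε, since it involves no limit in δ. -/
lemma map_fst_restrict_losing {ε : ℝ} (hε : ε ∈ Ioo (0 : ℝ) 1) {p : ℝ} (hp : p ∈ Ioc (0 : ℝ) 1) :
    ((perturbedBidder ε bid).restrict (Prod.snd ⁻¹' Iio p)).map Prod.fst
      = ENNReal.ofReal ((1 - ε) * invBid p + ε * p) •
        (mixture (share ((1 - ε) * invBid p) (ε * p)) (uniformPM (invBid p)) (uniformPM 1) :
          Measure ℝ) := by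
  have hx := invBid_pos hp.1
  have hε' : 0 < 1 - ε := sub_pos.2 hε.2
  rw [map_fst_restrict_perturbedBidder _ measurable_bid measurableSet_Iio,
    ofReal_smul_mixture_share (by positivity) (mul_pos hε.1 hp.1), coe_uniformPM hx,
    coe_uniformPM one_pos, restrict_bid_preimage_Iio hp.1, smul_smul,
    ← ENNReal.ofReal_mul hε'.le, ENNReal.ofReal_mul hε.1.le]
  congr 3
  rw [← ENNReal.ofReal_toReal (measure_ne_top (uniform 1) (Iio p)), ← measureReal_def,
    uniform_real_Iio ⟨hp.1.le, hp.2⟩, div_one]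

lemma measurableSet_ball (p δ : ℝ) : MeasurableSet {s : ℝ | |s - p| < δ} := by
  rw [abs_sub_lt_eq_Ioo]
  exact measurableSet_Ioo

lemma integral_map_fst_restrict_ball {ε : ℝ} (hε : ε ∈ Ioo (0 : ℝ) 1) (p δ : ℝ) (g : ℝ →ᵇ ℝ) :
    ∫ v, g v ∂((perturbedBidder ε bid).restrict (Prod.snd ⁻¹' {s | |s - p| < δ})).map Prod.fst
      = (1 - ε) * ∫ v in {v | |bid v - p| < δ}, g v ∂uniform 1
        + ε * (uniform 1).real {s | |s - p| < δ} * ∫ v, g v ∂uniform 1 := by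
  rw [map_fst_restrict_perturbedBidder _ measurable_bid (measurableSet_ball p δ),
    ← ENNReal.ofReal_toReal (measure_ne_top (uniform 1) {s | |s - p| < δ}), ← measureReal_def,
    ← ENNReal.ofReal_mul hε.1.le, integral_ofReal_smul_add (sub_pos.2 hε.2).le
    (mul_nonneg hε.1.le measureReal_nonneg) (g.integrable _) (g.integrable _)]
  rfl

lemma perturbedBidder_real_ball {ε : ℝ} (hε : ε ∈ Ioo (0 : ℝ) 1) (p δ : ℝ) :
    (perturbedBidder ε bid).real (Prod.snd ⁻¹' {s | |s - p| < δ})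
      = (1 - ε) * (uniform 1).real {v | |bid v - p| < δ}
        + ε * (uniform 1).real {s | |s - p| < δ} := by
  have h := integral_map_fst_restrict_ball hε p δ (BoundedContinuousFunction.const ℝ 1)
  rw [integral_map measurable_fst.aemeasurable (by fun_prop)] at h
  simpa using h

lemma perturbedBidder_real_ball_pos {ε : ℝ} (hε : ε ∈ Ioo (0 : ℝ) 1) {p : ℝ}
    (hp : p ∈ Ioc (0 : ℝ) 1) {δ : ℝ} (hδ : 0 < δ) :
    0 < (perturbedBidder ε bid).real (Prod.snd ⁻¹' {s | |s - p| < δ}) := by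
  rw [perturbedBidder_real_ball hε]
  exact add_pos_of_nonneg_of_pos (mul_nonneg (sub_pos.2 hε.2).le measureReal_nonneg)
    (mul_pos hε.1 (uniform_real_ball_pos hp hδ))

lemma tendsto_perturbedBidder_real_ball {ε : ℝ} (hε : ε ∈ Ioo (0 : ℝ) 1) (p : ℝ) :
    Tendsto (fun δ => (perturbedBidder ε bid).real (Prod.snd ⁻¹' {s | |s - p| < δ})) (𝓝[>] 0)
      (𝓝 0) := by
  have h1 : Tendsto (fun δ => invBid (p + δ) - invBid (p - δ)) (𝓝[>] 0) (𝓝 0) := by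
    have h : Continuous fun δ => invBid (p + δ) - invBid (p - δ) :=
      (continuous_invBid.comp (by fun_prop)).sub (continuous_invBid.comp (by fun_prop))
    exact tendsto_nhdsWithin_of_tendsto_nhds (by simpa using h.tendsto 0)
  have h2 := (h1.const_mul (1 - ε)).add ((tendsto_uniform_real_ball p).const_mul ε)
  rw [mul_zero, mul_zero, add_zero] at h2
  refine h2.congr' ?_
  filter_upwards [self_mem_nhdsWithin] with δ hδ
  rw [perturbedBidder_real_ball hε, uniform_real_preimage_bid_ball p (le_of_lt hδ)]

/-- The law of the value of a perturbed bidder, given that the bid is near `p`. -/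
lemma tendsto_winning {ε : ℝ} (hε : ε ∈ Ioo (0 : ℝ) 1) {p r : ℝ} (hp : p ∈ Ioc (0 : ℝ) 1)
    (hr0 : 0 ≤ r)
    (hr : Tendsto (fun δ => (uniform 1).real {v | |bid v - p| < δ}
      / (uniform 1).real {s | |s - p| < δ}) (𝓝[>] 0) (𝓝 r)) (g : ℝ →ᵇ ℝ) :
    Tendsto (fun δ => (∫ v, g v
        ∂((perturbedBidder ε bid).restrict (Prod.snd ⁻¹' {s | |s - p| < δ})).map Prod.fst)
        / (perturbedBidder ε bid).real (Prod.snd ⁻¹' {s | |s - p| < δ})) (𝓝[>] 0)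
      (𝓝 (∫ v, g v ∂(mixture (share ((1 - ε) * r) (ε * 1)) (diracProba (invBid p))
        (uniformPM 1) : Measure ℝ))) := by
  have hε' : 0 < 1 - ε := sub_pos.2 hε.2
  -- Numerator and denominator are both divided by the mass of the uniform bids near p, which is
  -- positive.
  have hnum := ((tendsto_setIntegral_density hr g.continuous).const_mul (1 - ε)).add_const
    (ε * ∫ v, g v ∂uniform 1)
  have hden := (hr.const_mul (1 - ε)).add_const ε
  rw [integral_mixture_share (by positivity) (by linarith [hε.1]), coe_uniformPM one_pos]
  have hd : ((diracProba (invBid p) : ProbabilityMeasure ℝ) : Measure ℝ)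
    = Measure.dirac (invBid p) := rfl
  rw [hd, integral_dirac, mul_one, mul_assoc]
  refine (hnum.div hden (by nlinarith [hε.1, mul_nonneg hε'.le hr0])).congr' ?_
  filter_upwards [self_mem_nhdsWithin] with δ hδ
  have h0 := uniform_real_ball_pos hp hδ
  rw [integral_map_fst_restrict_ball hε, perturbedBidder_real_ball hε]
  have h1 := measureReal_nonneg (μ := uniform 1) (s := {v | |bid v - p| < δ})
  have h2 := hε.1
  simp only [Pi.div_apply]
  have h3 : 0 < (1 - ε) * (uniform 1).real {v | |bid v - p| < δ}
      + ε * (uniform 1).real {s | |s - p| < δ} := by positivity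
  generalize (uniform 1).real {s | |s - p| < δ} = B at *
  generalize (uniform 1).real {v | |bid v - p| < δ} = A at *
  have h4 : 0 < (1 - ε) * (A / B) + ε := by positivity
  rw [div_eq_div_iff h4.ne' h3.ne']
  field_simp

/-! ### Posteriors -/

/-- Integrating out the values of the loser and of c turns a test function of three values into one
of the winner's value, as `tendsto_winning` requires. -/
lemma exists_integral_section (f : (ℝ × ℝ × ℝ) →ᵇ ℝ) (ρ : ProbabilityMeasure (ℝ × ℝ)) :
    ∃ g : ℝ →ᵇ ℝ, ∀ v, g v = ∫ y, f (v, y) ∂(ρ : Measure (ℝ × ℝ)) := by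
  have hcont : Continuous fun v => ∫ y, f (v, y) ∂(ρ : Measure (ℝ × ℝ)) := by
    refine continuous_of_dominated (bound := fun _ => ‖f‖)
      (fun v => ?_) (fun v => Eventually.of_forall fun y => f.norm_coe_le_norm _)
      (integrable_const _) (Eventually.of_forall fun y => by fun_prop)
    exact (f.continuous.comp (by fun_prop : Continuous fun y => (v, y))).aestronglyMeasurable
  refine ⟨BoundedContinuousFunction.ofNormedAddCommGroup _ hcont ‖f‖ fun v => ?_, fun v => rfl⟩
  refine (norm_integral_le_of_norm_le_const
    (Eventually.of_forall fun y => f.norm_coe_le_norm _)).trans_eq ?_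
  simp

lemma measurable_values : Measurable values := by
  unfold values
  fun_prop

lemma map_values_restrict {μ ν : Measure (ℝ × ℝ)} [SFinite μ] [SFinite ν] (S H : Set (ℝ × ℝ)) :
    ((μ.prod (ν.prod ((uniform 1).prod (uniform 1)))).restrict (S ×ˢ (H ×ˢ univ))).map values
      = ((μ.restrict S).map Prod.fst).prod (((ν.restrict H).map Prod.fst).prod (uniform 1)) := by
  have hU : uniform 1 = ((uniform 1).prod (uniform 1)).map Prod.fst := by
    rw [Measure.map_fst_prod, measure_univ, one_smul]
  have hv : values = Prod.map Prod.fst (Prod.map Prod.fst Prod.fst) := rfl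
  conv_rhs => rw [hU]
  rw [Measure.map_prod_map _ _ measurable_fst measurable_fst,
    Measure.map_prod_map _ _ measurable_fst (measurable_fst.prodMap measurable_fst),
    ← Measure.prod_restrict, ← Measure.prod_restrict, Measure.restrict_univ, hv]

/-- The mixture of a point mass at the equilibrium value and the prior: the law of the value of the
winner at price `p` of a perturbed auction. Here `r` is the density of the equilibrium bids. -/
def winnerPosterior (r p ε : ℝ) : ProbabilityMeasure ℝ :=
  mixture (share ((1 - ε) * r) (ε * 1)) (diracProba (invBid p)) (uniformPM 1)

/-- The law of the value of the loser of a perturbed auction with price `p`. -/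
def loserPosterior (p ε : ℝ) : ProbabilityMeasure ℝ :=
  mixture (share ((1 - ε) * invBid p) (ε * p)) (uniformPM (invBid p)) (uniformPM 1)

section Limit

variable {ε p r : ℝ}

/-- Up to ties and bids near `p` of both bidders, the first bidder wins at a price near `p` if the
own bid is near `p` and the other bid is below `p`. -/
lemma abs_setIntegral_sub_le {P : Measure (ℝ × ℝ)} [IsProbabilityMeasure P] {δ : ℝ} {E : Set Play}
    (hE : MeasurableSet E) (hE1 : ∀ ω ∈ E, |ω.1.2 - p| < δ ∧ ω.2.1.2 ≤ ω.1.2)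
    (hE2 : ∀ ω : Play, |ω.1.2 - p| < δ → ω.2.1.2 < ω.1.2 → ω ∈ E) (f : (ℝ × ℝ × ℝ) →ᵇ ℝ) :
    |∫ ω in E, f (values ω) ∂P.prod (P.prod ((uniform 1).prod (uniform 1)))
      - ∫ ω in (Prod.snd ⁻¹' {s | |s - p| < δ}) ×ˢ ((Prod.snd ⁻¹' Iio p) ×ˢ univ),
          f (values ω) ∂P.prod (P.prod ((uniform 1).prod (uniform 1)))|
      ≤ ‖f‖ * P.real (Prod.snd ⁻¹' {s | |s - p| < δ}) ^ 2 := by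
  set S : Set (ℝ × ℝ) := Prod.snd ⁻¹' {s | |s - p| < δ}
  set H : Set (ℝ × ℝ) := Prod.snd ⁻¹' Iio p
  have hS : MeasurableSet S := measurable_snd (measurableSet_ball p δ)
  have hH : MeasurableSet H := measurable_snd measurableSet_Iio
  have hE' : MeasurableSet (S ×ˢ (H ×ˢ univ) : Set Play) := hS.prod (hH.prod MeasurableSet.univ)
  have hD : MeasurableSet (S ×ˢ (S ×ˢ univ) : Set Play) := hS.prod (hS.prod MeasurableSet.univ)
  have hfv : Integrable (fun ω => f (values ω))
      (P.prod (P.prod ((uniform 1).prod (uniform 1)))) :=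
    Integrable.of_bound (f.continuous.measurable.comp measurable_values).aestronglyMeasurable ‖f‖
      (Eventually.of_forall fun ω => f.norm_coe_le_norm _)
  rw [← integral_indicator hE, ← integral_indicator hE',
    ← integral_sub (hfv.indicator hE) (hfv.indicator hE'), ← Real.norm_eq_abs]
  have hmass : ∫ ω, (S ×ˢ (S ×ˢ univ) : Set Play).indicator (fun _ => ‖f‖) ω
      ∂P.prod (P.prod ((uniform 1).prod (uniform 1))) = ‖f‖ * P.real S ^ 2 := by
    rw [integral_indicator_const _ hD, measureReal_prod_prod, measureReal_prod_prod,
      probReal_univ, smul_eq_mul]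
    ring
  rw [← hmass]
  refine norm_integral_le_of_norm_le ((integrable_const _).indicator hD)
    (Eventually.of_forall fun ω => ?_)
  have hf0 := norm_nonneg f
  have hfω := f.norm_coe_le_norm (values ω)
  by_cases h1 : ω ∈ E <;> by_cases h2 : ω ∈ (S ×ˢ (H ×ˢ univ) : Set Play)
  · rw [indicator_of_mem h1, indicator_of_mem h2, sub_self, norm_zero]
    exact indicator_nonneg (fun _ _ => hf0) _
  -- Here the other bid lies between p and the own bid, which is within δ of p.
  · have h3 : ω ∈ (S ×ˢ (S ×ˢ univ) : Set Play) := by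
      obtain ⟨h4, h5⟩ := hE1 ω h1
      have h6 : p ≤ ω.2.1.2 := by
        by_contra! h6
        exact h2 ⟨h4, h6, trivial⟩
      refine ⟨h4, ?_, trivial⟩
      rw [abs_lt] at h4
      change |ω.2.1.2 - p| < δ
      exact abs_lt.2 ⟨by linarith, by linarith⟩
    rw [indicator_of_mem h1, indicator_of_notMem h2, indicator_of_mem h3, sub_zero]
    exact hfω
  -- Here the other bid is below p but not below the own bid, so it is within δ of p too.
  · have h3 : ω ∈ (S ×ˢ (S ×ˢ univ) : Set Play) := by
      obtain ⟨h4, h5, -⟩ := h2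
      have h6 : ω.1.2 ≤ ω.2.1.2 := by
        by_contra! h6
        exact h1 (hE2 ω h4 h6)
      refine ⟨h4, ?_, trivial⟩
      have h4' := abs_lt.1 (show |ω.1.2 - p| < δ from h4)
      have h5' : ω.2.1.2 < p := h5
      change |ω.2.1.2 - p| < δ
      exact abs_lt.2 ⟨by linarith, by linarith⟩
    rw [indicator_of_notMem h1, indicator_of_mem h2, indicator_of_mem h3, zero_sub, norm_neg]
    exact hfω
  · rw [indicator_of_notMem h1, indicator_of_notMem h2, sub_self, norm_zero]
    exact indicator_nonneg (fun _ _ => hf0) _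

variable (hε : ε ∈ Ioo (0 : ℝ) 1) (hp : p ∈ Ioc (0 : ℝ) 1) (hr0 : 0 ≤ r)
  (hr : Tendsto (fun δ => (uniform 1).real {v | |bid v - p| < δ}
      / (uniform 1).real {s | |s - p| < δ}) (𝓝[>] 0) (𝓝 r)) {E : ℝ → Set Play}
  (hE : ∀ δ, MeasurableSet (E δ)) (hE1 : ∀ δ, ∀ ω ∈ E δ, |ω.1.2 - p| < δ ∧ ω.2.1.2 ≤ ω.1.2)
  (hE2 : ∀ δ, ∀ ω : Play, |ω.1.2 - p| < δ → ω.2.1.2 < ω.1.2 → ω ∈ E δ)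

include hε hp hr0 hr hE hE1 hE2

/-- Replacing the event by a product event costs at most ‖f‖ times the square of the probability of
a bid near p. Division by this probability leaves an error that tends to 0. -/
lemma tendsto_setIntegral_values (f : (ℝ × ℝ × ℝ) →ᵇ ℝ) :
    Tendsto (fun δ => (∫ ω in E δ, f (values ω) ∂perturbedLaw equilibriumProfile ε)
        / (perturbedBidder ε bid).real (Prod.snd ⁻¹' {s | |s - p| < δ})) (𝓝[>] 0)
      (𝓝 (((1 - ε) * invBid p + ε * p) * ∫ x, f x ∂((winnerPosterior r p ε).prod
        ((loserPosterior p ε).prod (uniformPM 1)) : Measure (ℝ × ℝ × ℝ)))) := by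
  have hP := isProbabilityMeasure_perturbedBidder ⟨hε.1.le, hε.2.le⟩ measurable_bid
  have hlaw : perturbedLaw equilibriumProfile ε = (perturbedBidder ε bid).prod
    ((perturbedBidder ε bid).prod ((uniform 1).prod (uniform 1))) := rfl
  have hc : 0 ≤ (1 - ε) * invBid p + ε * p :=
    add_nonneg (mul_nonneg (sub_pos.2 hε.2).le (invBid_mem p).1) (mul_nonneg hε.1.le hp.1.le)
  obtain ⟨g, hg⟩ := exists_integral_section f ((loserPosterior p ε).prod (uniformPM 1))
  have hprod : ∀ δ, ∫ ω in (Prod.snd ⁻¹' {s | |s - p| < δ}) ×ˢ ((Prod.snd ⁻¹' Iio p) ×ˢ univ),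
      f (values ω) ∂perturbedLaw equilibriumProfile ε = ((1 - ε) * invBid p + ε * p) * ∫ v, g v
        ∂((perturbedBidder ε bid).restrict (Prod.snd ⁻¹' {s | |s - p| < δ})).map Prod.fst := by
    intro δ
    rw [← integral_map (f := f) measurable_values.aemeasurable (f.continuous.aestronglyMeasurable),
      hlaw, map_values_restrict, map_fst_restrict_losing hε hp, Measure.prod_smul_left,
      Measure.prod_smul_right, integral_smul_measure, ENNReal.toReal_ofReal hc, smul_eq_mul,
      ← coe_uniformPM one_pos, integral_prod _ (f.integrable _)]
    simp only [hg]
    rfl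
  have hlim : ∫ x, f x ∂((winnerPosterior r p ε).prod
        ((loserPosterior p ε).prod (uniformPM 1)) : Measure (ℝ × ℝ × ℝ))
      = ∫ v, g v ∂(winnerPosterior r p ε : Measure ℝ) := by
    rw [ProbabilityMeasure.toMeasure_prod, integral_prod _ (f.integrable _)]
    simp only [hg]
  have h1 := (tendsto_winning hε hp hr0 hr g).const_mul ((1 - ε) * invBid p + ε * p)
  rw [hlim, winnerPosterior]
  have h2 : Tendsto (fun δ => (∫ ω in E δ, f (values ω) ∂perturbedLaw equilibriumProfile ε
      - ∫ ω in (Prod.snd ⁻¹' {s | |s - p| < δ}) ×ˢ ((Prod.snd ⁻¹' Iio p) ×ˢ univ),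
          f (values ω) ∂perturbedLaw equilibriumProfile ε)
        / (perturbedBidder ε bid).real (Prod.snd ⁻¹' {s | |s - p| < δ})) (𝓝[>] 0) (𝓝 0) := by
    have h3 := (tendsto_perturbedBidder_real_ball hε p).const_mul ‖f‖
    rw [mul_zero] at h3
    refine squeeze_zero_norm' ?_ h3
    filter_upwards [self_mem_nhdsWithin] with δ hδ
    have h4 := perturbedBidder_real_ball_pos hε hp (mem_Ioi.1 hδ)
    rw [norm_div, Real.norm_eq_abs, Real.norm_of_nonneg h4.le, div_le_iff₀ h4, mul_assoc, ← sq,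
      hlaw]
    exact abs_setIntegral_sub_le (hE δ) (hE1 δ) (hE2 δ) f
  have h5 := h2.add h1
  rw [zero_add] at h5
  refine h5.congr fun δ => ?_
  rw [hprod]
  ring

lemma tendsto_integral_cond (f : (ℝ × ℝ × ℝ) →ᵇ ℝ) :
    Tendsto (fun δ => ∫ ω, f (values ω)
        ∂(ProbabilityTheory.cond (perturbedLaw equilibriumProfile ε) (E δ))) (𝓝[>] 0)
      (𝓝 (∫ x, f x ∂((winnerPosterior r p ε).prod
        ((loserPosterior p ε).prod (uniformPM 1)) : Measure (ℝ × ℝ × ℝ)))) := by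
  have hc : 0 < (1 - ε) * invBid p + ε * p :=
    add_pos (mul_pos (sub_pos.2 hε.2) (invBid_pos hp.1)) (mul_pos hε.1 hp.1)
  have h1 := tendsto_setIntegral_values hε hp hr0 hr hE hE1 hE2 f
  -- The constant function 1 gives the probability of the conditioning event at the same scale, and
  -- the scale cancels in the quotient.
  have h2 := tendsto_setIntegral_values hε hp hr0 hr hE hE1 hE2
    (BoundedContinuousFunction.const _ 1)
  simp only [BoundedContinuousFunction.const_apply, integral_const, smul_eq_mul, mul_one,
    probReal_univ, measureReal_restrict_apply_univ] at h2
  have h3 := h1.div h2 hc.ne'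
  rw [mul_div_cancel_left₀ _ hc.ne'] at h3
  refine h3.congr' ?_
  filter_upwards [self_mem_nhdsWithin] with δ hδ
  have h4 := perturbedBidder_real_ball_pos hε hp (mem_Ioi.1 hδ)
  rw [Pi.div_apply, div_div_div_cancel_right₀ h4.ne', ProbabilityTheory.cond,
    integral_smul_measure, ENNReal.toReal_inv, smul_eq_mul, ← measureReal_def]
  ring

end Limit

/-! ### Symmetry between the early bidders -/

/-- Exchange of the first two components. -/
def swapFirst {α β : Type*} (x : α × α × β) : α × α × β := (x.2.1, x.1, x.2.2)

lemma measurable_swapFirst {α β : Type*} [MeasurableSpace α] [MeasurableSpace β] :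
    Measurable (swapFirst : α × α × β → α × α × β) := by
  unfold swapFirst
  fun_prop

lemma map_swapFirst {α β : Type*} [MeasurableSpace α] [MeasurableSpace β] (μ ν : Measure α)
    (ρ : Measure β) [SFinite μ] [SFinite ν] [SFinite ρ] :
    (μ.prod (ν.prod ρ)).map swapFirst = ν.prod (μ.prod ρ) := by
  have h1 := (measurePreserving_prodAssoc μ ν ρ).symm
  have h2 := (Measure.measurePreserving_swap (μ := μ) (ν := ν)).prod (MeasurePreserving.id ρ)
  have h3 := measurePreserving_prodAssoc ν μ ρ
  exact (h3.comp (h2.comp h1)).map_eq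

lemma cond_map {α β : Type*} [MeasurableSpace α] [MeasurableSpace β] (μ : Measure α) {s : α → β}
    (hs : Measurable s) {A : Set β} (hA : MeasurableSet A) :
    ProbabilityTheory.cond (μ.map s) A = (ProbabilityTheory.cond μ (s ⁻¹' A)).map s := by
  rw [ProbabilityTheory.cond, ProbabilityTheory.cond, Measure.restrict_map hs hA,
    Measure.map_apply hs hA, Measure.map_smul]

lemma continuous_swapFirst {α β : Type*} [TopologicalSpace α] [TopologicalSpace β] :
    Continuous (swapFirst : α × α × β → α × α × β) := by
  unfold swapFirst
  fun_prop

lemma measurableSet_winner (w : Early) : MeasurableSet {ω | winner ω = w} := by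
  have ha : MeasurableSet {ω | winner ω = Early.a} := by
    have : {ω | winner ω = Early.a} = {ω : Play | ω.2.1.2 < ω.1.2}
        ∪ ({ω | ω.1.2 < ω.2.1.2}ᶜ ∩ {ω | ω.2.2.2 < 1 / 2}) := by
      ext ω
      simp only [winner, mem_ofPred_eq, mem_union, mem_inter_iff, mem_compl_iff]
      split_ifs <;> simp_all
    rw [this]
    refine (measurableSet_lt (by fun_prop) (by fun_prop)).union
      ((measurableSet_lt (by fun_prop) (by fun_prop)).compl.inter
        (measurableSet_lt (by fun_prop) (by fun_prop)))
  cases w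
  · exact ha
  · have : {ω | winner ω = Early.b} = {ω | winner ω = Early.a}ᶜ := by
      ext ω
      simp only [mem_ofPred_eq, mem_compl_iff]
      cases winner ω <;> simp
    rw [this]
    exact ha.compl

lemma measurableSet_nearHistory (w : Early) (p δ : ℝ) : MeasurableSet (nearHistory w p δ) := by
  have hprice : Measurable fun ω => |price ω - p| := by
    unfold price
    fun_prop
  exact (measurableSet_winner w).inter (measurableSet_lt hprice measurable_const)

lemma winner_a_le {ω : Play} (h : winner ω = Early.a) : ω.2.1.2 ≤ ω.1.2 := by
  by_contra! h'
  simp [winner, h', h'.not_gt] at h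

lemma winner_b_le {ω : Play} (h : winner ω = Early.b) : ω.1.2 ≤ ω.2.1.2 := by
  by_contra! h'
  simp [winner, h'] at h

/-- The posterior of the values of `a`, `b` and `c`. -/
def posterior (w : Early) (r p ε : ℝ) : ProbabilityMeasure (ℝ × ℝ × ℝ) :=
  match w with
  | Early.a => (winnerPosterior r p ε).prod ((loserPosterior p ε).prod (uniformPM 1))
  | Early.b => (loserPosterior p ε).prod ((winnerPosterior r p ε).prod (uniformPM 1))

lemma isPosterior_posterior {ε p r : ℝ} (hε : ε ∈ Ioo (0 : ℝ) 1) (hp : p ∈ Ioc (0 : ℝ) 1)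
    (hr0 : 0 ≤ r) (hr : Tendsto (fun δ => (uniform 1).real {v | |bid v - p| < δ}
      / (uniform 1).real {s | |s - p| < δ}) (𝓝[>] 0) (𝓝 r)) (w : Early) :
    IsPosterior equilibriumProfile ε w p (posterior w r p ε) := by
  have hP := isProbabilityMeasure_perturbedBidder ⟨hε.1.le, hε.2.le⟩ measurable_bid
  intro f
  cases w
  · refine tendsto_integral_cond hε hp hr0 hr (fun δ => measurableSet_nearHistory _ p δ) ?_ ?_ f
    · rintro δ ω ⟨h1, h2⟩
      rw [price, max_eq_left (winner_a_le h1)] at h2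
      exact ⟨h2, winner_a_le h1⟩
    · intro δ ω h1 h2
      refine ⟨by simp [winner, h2], ?_⟩
      rwa [price, max_eq_left h2.le]
  -- Both early bidders use the same strategy, so the law is invariant under their exchange. The
  -- coin is not mirrored, which is harmless because the limit lemma allows any resolution of ties.
  · have hlaw : (perturbedLaw equilibriumProfile ε).map swapFirst
        = perturbedLaw equilibriumProfile ε :=
      map_swapFirst (perturbedBidder ε bid) (perturbedBidder ε bid) _
    have hlim : ∫ x, f x ∂(posterior Early.b r p ε : Measure (ℝ × ℝ × ℝ))
        = ∫ x, f.compContinuous ⟨swapFirst, continuous_swapFirst⟩ x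
          ∂((winnerPosterior r p ε).prod ((loserPosterior p ε).prod (uniformPM 1)) :
            Measure (ℝ × ℝ × ℝ)) := by
      have h1 : (posterior Early.b r p ε : Measure (ℝ × ℝ × ℝ))
          = (((winnerPosterior r p ε).prod ((loserPosterior p ε).prod (uniformPM 1)) :
            ProbabilityMeasure (ℝ × ℝ × ℝ)) : Measure (ℝ × ℝ × ℝ)).map swapFirst :=
        (map_swapFirst _ _ _).symm
      rw [h1, integral_map measurable_swapFirst.aemeasurable f.continuous.aestronglyMeasurable]
      rfl
    rw [hlim]
    refine (tendsto_integral_cond hε hp hr0 hr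
      (E := fun δ => swapFirst ⁻¹' nearHistory Early.b p δ)
      (fun δ => measurable_swapFirst (measurableSet_nearHistory _ p δ)) ?_ ?_ _).congr fun δ => ?_
    · rintro δ ω ⟨h1, h2⟩
      rw [price, max_eq_right (winner_b_le h1)] at h2
      exact ⟨h2, winner_b_le h1⟩
    · intro δ ω h1 h2
      refine ⟨by simp [winner, swapFirst, h2, h2.not_gt], ?_⟩
      rw [price, max_eq_right (show (swapFirst ω).1.2 ≤ (swapFirst ω).2.1.2 from h2.le)]
      exact h1
    · conv_rhs => rw [← hlaw]
      rw [cond_map _ measurable_swapFirst (measurableSet_nearHistory _ p δ),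
        integral_map (f := fun ω => f (values ω)) measurable_swapFirst.aemeasurable
          (f.continuous.measurable.comp measurable_values).aestronglyMeasurable]
      rfl

/-! ### The equilibrium -/

/-- The equilibrium belief about the value of the winner of the first auction. -/
def winnerBelief (p : ℝ) : ProbabilityMeasure ℝ :=
  if p ≤ bid 1 then diracProba (invBid p) else uniformPM 1

/-- The equilibrium beliefs. -/
def equilibriumBeliefs : BeliefSystem where
  early w p j := match w, j with
    | Early.a, Early.a => winnerBelief p
    | Early.a, Early.b => uniformPM (invBid p)
    | Early.b, Early.a => uniformPM (invBid p)
    | Early.b, Early.b => winnerBelief p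
  late _ _ := uniformPM 1

lemma equilibriumBeliefs_other (w : Early) (p : ℝ) :
    equilibriumBeliefs.early w p w.other = uniformPM (invBid p) := by
  cases w <;> rfl

lemma isConsistent_equilibrium : IsConsistent equilibriumProfile equilibriumBeliefs := by
  intro w p hp
  obtain ⟨r, hr0, hpos, hzero, hr⟩ := exists_tendsto_density hp
  refine ⟨posterior w r p, fun ε hε => isPosterior_posterior hε hp hr0 hr w, ?_⟩
  have hw : Tendsto (winnerPosterior r p) (𝓝[>] 0) (𝓝 (winnerBelief p)) := by
    unfold winnerPosterior winnerBelief
    split_ifs with h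
    · have := tendsto_mixture (tendsto_share (q := 1) (hpos h)) (diracProba (invBid p))
        (uniformPM 1)
      rwa [mixture_one] at this
    -- Above b(1) only random bids occur near p, so the winner's posterior is the prior for every ε.
    · simp only [hzero (not_le.1 h), mul_zero, share_zero, mixture_zero]
      exact tendsto_const_nhds
  have hl : Tendsto (loserPosterior p) (𝓝[>] 0) (𝓝 (uniformPM (invBid p))) := by
    have := tendsto_mixture (tendsto_share (q := p) (invBid_pos hp.1)) (uniformPM (invBid p))
      (uniformPM 1)
    rwa [mixture_one] at this
  have hprod : ∀ {q q' : ℝ → ProbabilityMeasure ℝ} {Q Q' : ProbabilityMeasure ℝ},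
      Tendsto q (𝓝[>] 0) (𝓝 Q) → Tendsto q' (𝓝[>] 0) (𝓝 Q') →
      Tendsto (fun ε => (q ε).prod ((q' ε).prod (uniformPM 1))) (𝓝[>] (0 : ℝ))
        (𝓝 (Q.prod (Q'.prod (uniformPM 1)))) := fun {q q' Q Q'} h h' =>
    have h2 := (ProbabilityMeasure.continuous_prod.tendsto (Q', uniformPM 1)).comp
      (h'.prodMk_nhds tendsto_const_nhds)
    (ProbabilityMeasure.continuous_prod.tendsto (Q, Q'.prod (uniformPM 1))).comp
      (h.prodMk_nhds h2)
  cases w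
  · exact hprod hw hl
  · exact hprod hl hw

lemma isSequentiallyRational_equilibrium :
    IsSequentiallyRational equilibriumProfile equilibriumBeliefs where
  first i v hv β hβ d _ hd' :=
    (earlyPayoff_le i hv hβ.1 hd').trans_eq (earlyPayoff_equilibrium i hv).symm
  loser w p hp v hv β hβ := by
    have h := loser_optimal ⟨invBid_pos hp.1, (invBid_mem p).2⟩ hv.1 hβ.1
    rw [loserGain, ← coe_uniformPM one_pos] at h
    exact h
  late w p hp v hv β hβ := by
    have h := late_optimal ⟨invBid_pos hp.1, (invBid_mem p).2⟩ hv hβ.1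
    unfold latePayoff
    rw [equilibriumBeliefs_other, coe_uniformPM (invBid_pos hp.1)]
    exact h

end

end SequentialAuction

theorem mainTheorem5 :
    ∃ (σ : SequentialAuction.StrategyProfile) (μ : SequentialAuction.BeliefSystem),
      SequentialAuction.IsSequentialEquilibrium σ μ ∧
      -- first auction
      (∀ i, σ.first i 0 = 0) ∧
      (∀ i, ∀ v ∈ Set.Ioc (0 : ℝ) 1, σ.first i v = 1 - Real.log (1 + v) / v) ∧
      -- beliefs after a price in the range of the equilibrium bids
      (∀ w, ∀ x ∈ Set.Ioc (0 : ℝ) 1,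
        (μ.early w (1 - Real.log (1 + x) / x) w.other : MeasureTheory.Measure ℝ)
          = SequentialAuction.uniform x) ∧
      -- beliefs after a price above that range
      (∀ w, ∀ p ∈ Set.Ioc (1 - Real.log 2) 1,
        (μ.early w p w.other : MeasureTheory.Measure ℝ) = SequentialAuction.uniform 1) ∧
      -- beliefs about the bidder who wants only the second item
      (∀ w, ∀ p ∈ Set.Ioc (0 : ℝ) 1,
        (μ.late w p : MeasureTheory.Measure ℝ) = SequentialAuction.uniform 1) ∧
      -- second auction after a price in the range of the equilibrium bids
      (∀ w, ∀ x ∈ Set.Ioc (0 : ℝ) 1,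
        (∀ v ∈ Set.Icc (0 : ℝ) x, σ.loser w (1 - Real.log (1 + x) / x) v
          = v / (1 + Real.sqrt (1 - (1 / x ^ 2 - 1) * v ^ 2))) ∧
        (∀ v ∈ Set.Icc (0 : ℝ) 1, σ.late w (1 - Real.log (1 + x) / x) v
          = v / (1 + Real.sqrt (1 + (1 / x ^ 2 - 1) * v ^ 2)))) ∧
      -- second auction after a price above that range
      (∀ w, ∀ p ∈ Set.Ioc (1 - Real.log 2) 1, ∀ v ∈ Set.Icc (0 : ℝ) 1,
        σ.loser w p v = v / 2 ∧ σ.late w p v = v / 2) := by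
  open SequentialAuction in
  have hinv : ∀ x ∈ Set.Ioc (0 : ℝ) 1, invBid (1 - Real.log (1 + x) / x) = x := fun x hx => by
    rw [← bid_of_pos hx.1, invBid_bid ⟨hx.1.le, hx.2⟩]
  have htop : ∀ p ∈ Set.Ioc (1 - Real.log 2) 1, invBid p = 1 := fun p hp =>
    invBid_of_bid_one_le (bid_one.trans_le hp.1.le)
  refine ⟨equilibriumProfile, equilibriumBeliefs,
    ⟨isSequentiallyRational_equilibrium, isConsistent_equilibrium⟩, fun i => bid_zero,
    fun i v hv => bid_of_pos hv.1, fun w x hx => ?_, fun w p hp => ?_,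
    fun w p _ => coe_uniformPM one_pos, fun w x hx => ⟨fun v hv => ?_, fun v _ => ?_⟩,
    fun w p hp v hv => ⟨?_, ?_⟩⟩
  · rw [equilibriumBeliefs_other, hinv x hx, coe_uniformPM hx.1]
  · rw [equilibriumBeliefs_other, htop p hp, coe_uniformPM one_pos]
  · change loserBid (invBid _) v = _
    rw [hinv x hx, loserBid_of_le hv.2]
  · change lateBid (invBid _) v = _
    rw [hinv x hx, lateBid]
  · change loserBid (invBid p) v = _
    rw [htop p hp, loserBid_of_le hv.2]
    -- Above b(1) the inverse bid is 1, so k = 0 and the denominator is 1 + √1 = 2.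
    norm_num
  · change lateBid (invBid p) v = _
    rw [htop p hp, lateBid]
    norm_num
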